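/- Let $n,r,d\ge 0$ be integers, let $m=rn$, and let $U=\{u_1\prec\dots\prec u_n\}$ and $V=\{v_1\prec\dots\prec v_n\}$ be totally ordered sets. An $r$-regular bipartite multigraph $G$ with color classes $U,V$ is given by the multiplicities of the pairs $(u,v)\in U\times V$, every vertex having degree $r$. A planar matching of $G$ is a set of edges such that any two distinct edges $uv$, $u'v'$ in it satisfy $u\prec u'$ and $v\prec v'$, or $u'\prec u$ and $v'\prec v$. Let $G_r(U,V;d)$ be the set of $r$-regular bipartite multigraphs on $U,V$ whose largest planar matching has at most $d$ edges, and let $g(n;d)=|G_r(U,V;d)|$. Write $u^s=(u,s)$ and $v^s=(v,s)$ for $s\in[r]$. The configuration $\overline G$ associated with an $r$-regular multigraph $G$ is the bijection $U\times[r]\to V\times[r]$ defined as follows: if $(u,v)$ has multiplicity $t$ in $G$, if $i$ edges $(u,v')$ of $G$ have $v\prec v'$, and if $j$ edges $(u',v)$ of $G$ have $u\prec u'$ (all counted with multiplicity), then $u^{i+s}$ is paired with $v^{j+t-s+1}$ for every $s\in[t]$. Let $\overline G_r(U,V;d)=\{\overline G : G\in G_r(U,V;d)\}$. Identifying $u_i^s$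 and $v_i^s$ with the integer $r(i-1)+s$, each configuration becomes a permutation $\pi$ of $[m]$. The RSK correspondence $\pi\mapsto(P(\pi),Q(\pi))$ row-inserts $\pi(1),\dots,\pi(m)$ successively into the empty tableau to obtain $P(\pi)$, and puts $k$ into the box of $Q(\pi)$ corresponding to the box created by the $k$-th insertion. A standard Young tableau with entries in $[m]$ is a left-justified array with weakly decreasing row lengths in which each element of $[m]$ occurs exactly once, with rows increasing from left to right and columns increasing from top to bottom. It satisfies Condition (T) if for all $i\in[n]$ and $1\le s<r$ the row containing $r(i-1)+s$ is strictly above the row containing $r(i-1)+s+1$. Then RSK restricts to a bijection from $\overline G_r(U,V;d)$ onto the set of pairs $(P,Q)$ of standard Young tableaux of equal shape with entries in $[m]$ and at most $d$ columns such that both $P$ and $Q$ satisfy Condition (T). Moreover $g(n;d)$ equals the (finite) number of such pairs. -/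

import Mathlib

set_option linter.unusedSectionVars false

namespace PlanarRSK

section Multigraphs

variable {U V : Type*} [LinearOrder U] [Fintype U] [LinearOrder V] [Fintype V] {r : ℕ}

/-- An `r`-regular bipartite multigraph with color classes `U` and `V`, given by the multiplicity
`mult u v` of each pair `(u, v)`; every vertex has degree `r`. -/
@[ext]
structure RegularMultigraph (U V : Type*) [Fintype U] [Fintype V] (r : ℕ) where
  mult : U → V → ℕ
  degree_left : ∀ u, ∑ v, mult u v = r
  degree_right : ∀ v, ∑ u, mult u v = r

namespace RegularMultigraph

/-- The edges of `G`: there are `mult u v` parallel edges joining `u` and `v`. -/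
abbrev Edge (G : RegularMultigraph U V r) : Type _ := Σ u : U, Σ v : V, Fin (G.mult u v)

/-- The edges `uv` and `u'v'` are noncrossing if `u ≺ u'` and `v ≺ v'`, or `u' ≺ u` and
`v' ≺ v`. -/
def Noncrossing {G : RegularMultigraph U V r} (e e' : G.Edge) : Prop :=
  (e.1 < e'.1 ∧ e.2.1 < e'.2.1) ∨ (e'.1 < e.1 ∧ e'.2.1 < e.2.1)

/-- A planar matching is a set of edges of which any two distinct ones are noncrossing
(in particular they share no endpoint). -/
def IsPlanarMatching (G : RegularMultigraph U V r) (M : Finset G.Edge) : Prop :=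
  ∀ e ∈ M, ∀ e' ∈ M, e ≠ e' → Noncrossing e e'

open Classical in
/-- `L(G)`: the number of edges of a largest planar matching of `G`. -/
noncomputable def maxPlanarMatching (G : RegularMultigraph U V r) : ℕ :=
  (Finset.univ.filter fun M : Finset G.Edge => G.IsPlanarMatching M).sup Finset.card

/-- The number of edges `(u, v')` of `G` with `v ≺ v'`. -/
def leftOffset (G : RegularMultigraph U V r) (u : U) (v : V) : ℕ :=
  ∑ v' ∈ Finset.univ.filter (fun v' => v < v'), G.mult u v'

/-- The number of edges `(u', v)` of `G` with `u ≺ u'`. -/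
def rightOffset (G : RegularMultigraph U V r) (u : U) (v : V) : ℕ :=
  ∑ u' ∈ Finset.univ.filter (fun u' => u < u'), G.mult u' v

theorem leftOffset_add_mult_le (G : RegularMultigraph U V r) (u : U) (v : V) :
    G.leftOffset u v + G.mult u v ≤ r := by
  have h : v ∉ Finset.univ.filter (fun v' => v < v') := by simp
  rw [leftOffset, add_comm, ← Finset.sum_insert h]
  refine le_of_le_of_eq ?_ (G.degree_left u)
  exact Finset.sum_le_sum_of_subset (Finset.subset_univ _)

theorem rightOffset_add_mult_le (G : RegularMultigraph U V r) (u : U) (v : V) :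
    G.rightOffset u v + G.mult u v ≤ r := by
  have h : u ∉ Finset.univ.filter (fun u' => u < u') := by simp
  rw [rightOffset, add_comm, ← Finset.sum_insert (f := fun u' => G.mult u' v) h]
  refine le_of_le_of_eq ?_ (G.degree_right v)
  exact Finset.sum_le_sum_of_subset (f := fun u' => G.mult u' v) (Finset.subset_univ _)

theorem leftOffset_add_mult_le_of_lt (G : RegularMultigraph U V r) (u : U) {v w : V}
    (h : v < w) : G.leftOffset u w + G.mult u w ≤ G.leftOffset u v := by
  have hw : w ∉ Finset.univ.filter (fun v' => w < v') := by simp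
  rw [leftOffset, leftOffset, add_comm, ← Finset.sum_insert hw]
  apply Finset.sum_le_sum_of_subset
  intro x hx
  simp only [Finset.mem_insert, Finset.mem_filter, Finset.mem_univ, true_and] at hx ⊢
  rcases hx with rfl | hx
  · exact h
  · exact h.trans hx

theorem rightOffset_add_mult_le_of_lt (G : RegularMultigraph U V r) (v : V) {u w : U}
    (h : u < w) : G.rightOffset w v + G.mult w v ≤ G.rightOffset u v := by
  have hw : w ∉ Finset.univ.filter (fun u' => w < u') := by simp
  rw [rightOffset, rightOffset, add_comm,
    ← Finset.sum_insert (f := fun u' => G.mult u' v) hw]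
  apply Finset.sum_le_sum_of_subset (f := fun u' => G.mult u' v)
  intro x hx
  simp only [Finset.mem_insert, Finset.mem_filter, Finset.mem_univ, true_and] at hx ⊢
  rcases hx with rfl | hx
  · exact h
  · exact h.trans hx

/-- The endpoint in `U × [r]` assigned to an edge. All indices are shifted to start at `0`: if
`(u, v)` has multiplicity `t` and `i` edges `(u, v')` have `v ≺ v'`, then the `s`-th of the `t`
parallel edges receives `u^{i+s}`. -/
def leftEnd (G : RegularMultigraph U V r) (e : G.Edge) : U × Fin r :=
  (e.1, ⟨G.leftOffset e.1 e.2.1 + e.2.2,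
    lt_of_lt_of_le (Nat.add_lt_add_left e.2.2.isLt _) (G.leftOffset_add_mult_le _ _)⟩)

/-- The endpoint in `V × [r]` assigned to an edge: if `(u, v)` has multiplicity `t` and `j` edges
`(u', v)` have `u ≺ u'`, then the `s`-th of the `t` parallel edges receives `v^{j+t-s+1}` (with
`s` counted from `1`), so parallel edges are used in reversed order. -/
def rightEnd (G : RegularMultigraph U V r) (e : G.Edge) : V × Fin r :=
  (e.2.1, ⟨G.rightOffset e.1 e.2.1 + e.2.2.rev,
    lt_of_lt_of_le (Nat.add_lt_add_left e.2.2.rev.isLt _)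
      (G.rightOffset_add_mult_le _ _)⟩)

theorem leftEnd_bijective (G : RegularMultigraph U V r) : Function.Bijective G.leftEnd := by
  rw [Fintype.bijective_iff_injective_and_card]
  constructor
  · rintro ⟨u, v, s⟩ ⟨u', v', s'⟩ h
    simp only [leftEnd, Prod.mk.injEq, Fin.mk.injEq] at h
    obtain ⟨rfl, h⟩ := h
    have hs := s.isLt
    have hs' := s'.isLt
    rcases lt_trichotomy v v' with hv | rfl | hv
    · have := G.leftOffset_add_mult_le_of_lt u hv
      omega
    · have : s = s' := Fin.ext (by omega)
      rw [this]
    · have := G.leftOffset_add_mult_le_of_lt u hv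
      omega
  · simp [Fintype.card_sigma, G.degree_left]

theorem rightEnd_bijective (G : RegularMultigraph U V r) : Function.Bijective G.rightEnd := by
  rw [Fintype.bijective_iff_injective_and_card]
  constructor
  · rintro ⟨u, v, s⟩ ⟨u', v', s'⟩ h
    simp only [rightEnd, Prod.mk.injEq, Fin.mk.injEq] at h
    obtain ⟨rfl, h⟩ := h
    have hs := s.rev.isLt
    have hs' := s'.rev.isLt
    rcases lt_trichotomy u u' with hu | rfl | hu
    · have := G.rightOffset_add_mult_le_of_lt v hu
      omega
    · have : s = s' := Fin.rev_injective (Fin.ext (by omega))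
      rw [this]
    · have := G.rightOffset_add_mult_le_of_lt v hu
      omega
  · simp only [Fintype.card_sigma, Fintype.card_fin, Fintype.card_prod]
    rw [Finset.sum_comm]
    simp [G.degree_right]

end RegularMultigraph

/-- An `r`-configuration of `U` and `V`: a one-to-one pairing of `U × [r]` and `V × [r]`. -/
abbrev Configuration (U V : Type*) (r : ℕ) : Type _ := (U × Fin r) ≃ (V × Fin r)

/-- The configuration associated with `G`: it pairs `leftEnd e` with `rightEnd e`, for every
edge `e` of `G`. -/
noncomputable def RegularMultigraph.toConfiguration (G : RegularMultigraph U V r) :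
    Configuration U V r :=
  (Equiv.ofBijective G.leftEnd G.leftEnd_bijective).symm.trans
    (Equiv.ofBijective G.rightEnd G.rightEnd_bijective)

/-- The `r`-regular bipartite multigraphs on `U` and `V` whose largest planar matching has at most
`d` edges. If `|U| = |V| = n`, their number is `g(n;d)`. -/
def planarMultigraphs (U V : Type*) [LinearOrder U] [Fintype U] [LinearOrder V] [Fintype V]
    (r d : ℕ) : Set (RegularMultigraph U V r) :=
  {G | G.maxPlanarMatching ≤ d}

/-- The configurations associated with the multigraphs in `planarMultigraphs U V r d`. -/
def planarConfigurations (U V : Type*) [LinearOrder U] [Fintype U] [LinearOrder V] [Fintype V]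
    (r d : ℕ) : Set (Configuration U V r) :=
  RegularMultigraph.toConfiguration '' planarMultigraphs U V r d

/-- The rank of an element of `U × [r]` in the lexicographic order. If `u_1 ≺ ... ≺ u_n` are the
elements of `U`, then `u_i^s` has rank `r (i - 1) + s`; here all of `i`, `s` and the rank are
shifted to start at `0`. -/
def lexRank {n : ℕ} (hU : Fintype.card U = n) : U × Fin r ≃ Fin (n * r) :=
  ((Fintype.orderIsoFinOfCardEq U hU).symm.toEquiv.prodCongr (Equiv.refl (Fin r))).trans
    finProdFinEquiv

/-- The permutation of `[rn]` determined by a configuration. -/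
def Configuration.toPerm {n : ℕ} (hU : Fintype.card U = n) (hV : Fintype.card V = n)
    (F : Configuration U V r) : Equiv.Perm (Fin (n * r)) :=
  ((lexRank hU).symm.trans F).trans (lexRank hV)

end Multigraphs

section Tableaux

/-- An arrangement of integers in left-justified rows, listed from top to bottom. -/
abbrev Filling : Type := List (List ℕ)

/-- The shape: the list of row lengths. -/
def shape (T : Filling) : List ℕ := T.map List.length

/-- `T` is a standard Young tableau in which each of `1, ..., m` occurs exactly once. (Empty rows
are not listed, so each tableau is represented exactly once.) -/
structure IsStandardTableau (m : ℕ) (T : Filling) : Prop where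
  rows_ne_nil : ∀ R ∈ T, R ≠ []
  shape_antitone : (shape T).Pairwise (fun a b => b ≤ a)
  rows_increasing : ∀ R ∈ T, R.Pairwise (fun x y => x < y)
  cols_increasing : T.Pairwise fun (R S : List ℕ) =>
    ∀ j x y : ℕ, R[j]? = some x → S[j]? = some y → x < y
  entries : T.flatten.Perm (List.range' 1 m)

/-- The number of columns: the length of the first row. -/
def numCols (T : Filling) : ℕ := (T.headD []).length

/-- The index (from the top, starting at `0`) of the row containing `x`. -/
def rowOf (T : Filling) (x : ℕ) : ℕ := T.findIdx fun R => decide (x ∈ R)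

/-- Condition (T): for each `i ∈ [n]` and `1 ≤ s < r`, the row containing `r (i - 1) + s` is
strictly above the row containing `r (i - 1) + s + 1`. -/
def ConditionT (n r : ℕ) (T : Filling) : Prop :=
  ∀ i s, 1 ≤ i → i ≤ n → 1 ≤ s → s < r →
    rowOf T (r * (i - 1) + s) < rowOf T (r * (i - 1) + s + 1)

/-- Pairs of standard Young tableaux of equal shape on the entries `1, ..., rn`, with at most `d`
columns, both satisfying condition (T). -/
def tableauPairs (n r d : ℕ) : Set (Filling × Filling) :=
  {p | IsStandardTableau (n * r) p.1 ∧ IsStandardTableau (n * r) p.2 ∧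
    shape p.1 = shape p.2 ∧ numCols p.1 ≤ d ∧ numCols p.2 ≤ d ∧
    ConditionT n r p.1 ∧ ConditionT n r p.2}

/-- Row insertion of `x` into a single row: `x` replaces the leftmost entry larger than `x`, which
is returned as the bumped entry; if there is none, `x` is put at the end of the row. -/
def rowInsert (x : ℕ) : List ℕ → List ℕ × Option ℕ
  | [] => ([x], none)
  | y :: R => if x < y then (x :: R, some y) else (y :: (rowInsert x R).1, (rowInsert x R).2)

/-- Row insertion `T ← x`. It returns the new tableau and the row in which the new box was
created (that box is the last one of its row). -/
def tableauInsert (x : ℕ) : Filling → Filling × ℕ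
  | [] => ([[x]], 0)
  | R :: T =>
    match rowInsert x R with
    | (R', none) => (R' :: T, 0)
    | (R', some y) => (R' :: (tableauInsert y T).1, (tableauInsert y T).2 + 1)

/-- Put a new box with entry `x` at the end of row `k` (a new row if `T` has only `k` rows). -/
def addBox (x : ℕ) : ℕ → Filling → Filling
  | _, [] => [[x]]
  | 0, R :: T => (R ++ [x]) :: T
  | k + 1, R :: T => R :: addBox x k T

/-- The RSK correspondence `π ↦ (P(π), Q(π))`: `π(1), ..., π(m)` are row-inserted one after the
other into `P`, and the box created by the `i`-th insertion receives the entry `i` in `Q`. -/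
def rsk {m : ℕ} (π : Equiv.Perm (Fin m)) : Filling × Filling :=
  (List.finRange m).foldl
    (fun PQ i =>
      ((tableauInsert (π i + 1) PQ.1).1,
        addBox (i + 1) (tableauInsert (π i + 1) PQ.1).2 PQ.2))
    ([], [])

end Tableaux

end PlanarRSK

namespace PlanarRSK

/-! ### Row insertion into a single row -/

section RowInsertion

/-! RSK is a bijection from permutations of `[m]` to pairs of standard tableaux of equal shape: the
largest label of `Q` marks the box created last, and the insertion that created it can be undone
from that box (`rskRev_injective`, `exists_rskRev_eq`). It remains to recognise the image of the
configurations, and for this three statistics of `π` are read off the tableaux.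

The label `i` lies strictly above `i + 1` in `Q` exactly when `π(i) > π(i + 1)`, by comparing two
consecutive insertions (`rowOf_rskRev_snd_lt_iff`). The entry `k` lies strictly above `k + 1` in `P`
exactly when `k + 1` precedes `k` in the word; here the symmetry of RSK under inversion is not
needed, since a bump never exchanges two consecutive values in the reading word
(`rowOf_rskRev_fst_lt_iff`). The number of columns is the length of a longest increasing
subsequence, by Schensted (`numCols_rskRev_le_iff`).

Hence Condition (T) for both tableaux says that `π` and its inverse decrease on every block of `r`
consecutive integers. The configurations with this property are exactly those coming from
multigraphs: once both directions decrease on blocks, the multiplicities determine all upper indices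
(`toConfiguration_toMultigraph`). Finally, an increasing subsequence cannot use a block twice on
either side, so it is the same thing as a planar matching (`maxPlanarMatching_le_iff`). The
cardinalities agree because a multigraph can be recovered from its configuration. -/

/-- Later arguments use this dichotomy (append, or bump at index `i`) in place of the recursion. As
`x` is not in the row, passing over an entry means that it is strictly smaller. -/
theorem rowInsert_spec (x : ℕ) (R : List ℕ) (hx : x ∉ R) :
    ((rowInsert x R).2 = none ∧ (rowInsert x R).1 = R ++ [x] ∧ ∀ a ∈ R, a < x) ∨
    ∃ i y, (rowInsert x R).2 = some y ∧ (rowInsert x R).1 = R.set i x ∧ R[i]? = some y ∧ x < y ∧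
      ∀ j a, j < i → R[j]? = some a → a < x := by
  induction R with
  | nil => simp [rowInsert]
  | cons z R ih =>
    have hz : x ≠ z := fun h => hx (by simp [h])
    have hR : x ∉ R := fun h => hx (by simp [h])
    by_cases h : x < z
    · right
      exact ⟨0, z, by simp [rowInsert, h]⟩
    · rcases ih hR with ⟨h1, h2, h3⟩ | ⟨i, y, h1, h2, h3, h4, h5⟩
      · left
        simp only [rowInsert, h, if_false, h1, h2]
        refine ⟨trivial, rfl, ?_⟩
        intro a ha
        rcases List.mem_cons.1 ha with rfl | ha
        · omega
        · exact h3 a ha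
      · right
        refine ⟨i + 1, y, by simp [rowInsert, h, h1], by simp [rowInsert, h, h2], by simpa using h3,
          h4, ?_⟩
        intro j a hj ha
        cases j with
        | zero => simp at ha; omega
        | succ j => exact h5 j a (by omega) (by simpa using ha)

theorem rowInsert_eq_append {x : ℕ} {R : List ℕ} (h : ∀ a ∈ R, a < x) :
    rowInsert x R = (R ++ [x], none) := by
  induction R with
  | nil => simp [rowInsert]
  | cons z R ih =>
    have hz : ¬ x < z := by have := h z (by simp); omega
    simp [rowInsert, hz, ih fun a ha => h a (by simp [ha])]

theorem rowInsert_eq_set {x y i : ℕ} {R : List ℕ} (hy : R[i]? = some y) (hxy : x < y)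
    (h : ∀ j a, j < i → R[j]? = some a → a < x) :
    rowInsert x R = (R.set i x, some y) := by
  induction R generalizing i with
  | nil => simp at hy
  | cons z R ih =>
    cases i with
    | zero =>
      simp at hy
      subst hy
      simp [rowInsert, hxy]
    | succ i =>
      have hz : ¬ x < z := by have := h 0 z (by omega) (by simp); omega
      simp only [List.getElem?_cons_succ] at hy
      simp [rowInsert, hz, ih hy fun j a hj ha => h (j + 1) a (by omega) (by simpa using ha)]

theorem pairwise_lt_iff_getElem? {R : List ℕ} :
    R.Pairwise (· < ·) ↔ ∀ i j x y : ℕ, i < j → R[i]? = some x → R[j]? = some y → x < y := by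
  rw [List.pairwise_iff_getElem]
  constructor
  · intro h i j x y hij hx hy
    obtain ⟨hi, rfl⟩ := List.getElem?_eq_some_iff.1 hx
    obtain ⟨hj, rfl⟩ := List.getElem?_eq_some_iff.1 hy
    exact h i j hi hj hij
  · intro h i j hi hj hij
    exact h i j _ _ hij (List.getElem?_eq_getElem hi) (List.getElem?_eq_getElem hj)

theorem rowInsert_pairwise {x : ℕ} {R : List ℕ} (hR : R.Pairwise (· < ·)) (hx : x ∉ R) :
    (rowInsert x R).1.Pairwise (· < ·) := by
  rcases rowInsert_spec x R hx with ⟨-, h2, h3⟩ | ⟨i, y, -, h2, h3, h4, h5⟩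
  · rw [h2, List.pairwise_append]
    simpa [hR] using h3
  · rw [h2, pairwise_lt_iff_getElem?]
    rw [pairwise_lt_iff_getElem?] at hR
    intro a b u v hab hu hv
    simp only [List.getElem?_set] at hu hv
    have k1 := hR a b u v hab
    have k2 := hR a b y v hab
    have k3 := h5 a u
    clear hR h5 hx h2
    grind

theorem rowInsert_perm {x : ℕ} {R : List ℕ} :
    ((rowInsert x R).2.toList ++ (rowInsert x R).1).Perm (x :: R) := by
  induction R with
  | nil => simp [rowInsert]
  | cons z R ih =>
    by_cases h : x < z
    · simp only [rowInsert, h, if_true, Option.toList_some, List.singleton_append]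
      exact List.Perm.swap _ _ _
    · simp only [rowInsert, h, if_false]
      exact (List.perm_middle.trans (ih.cons z)).trans (List.Perm.swap _ _ _)

end RowInsertion

/-! ### Insertion into tableaux, its reversal, and adding boxes -/

section Tableaux

/-- Row `R` may stand directly above row `S` in a tableau. -/
def Dominates (R S : List ℕ) : Prop :=
  S.length ≤ R.length ∧ ∀ j x y : ℕ, R[j]? = some x → S[j]? = some y → x < y

/-- Fillings with nonempty increasing rows, each of which dominates the next one. -/
def IsTableau : Filling → Prop
  | [] => True
  | R :: T => R ≠ [] ∧ R.Pairwise (· < ·) ∧ Dominates R (T.headD []) ∧ IsTableau T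

theorem Dominates.trans {R S T : List ℕ} (h : Dominates R S) (h' : Dominates S T) :
    Dominates R T := by
  refine ⟨h'.1.trans h.1, fun j x y hx hy => ?_⟩
  have hj : j < S.length := lt_of_lt_of_le (List.getElem?_eq_some_iff.1 hy).1 h'.1
  exact (h.2 j x _ hx (List.getElem?_eq_getElem hj)).trans
    (h'.2 j _ y (List.getElem?_eq_getElem hj) hy)

theorem dominates_nil (R : List ℕ) : Dominates R [] := by simp [Dominates]

/-- Domination is transitive because the middle row is long enough to have an entry in every column
of the lower one. So the recursive form, suited to induction along insertion, agrees with the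
pairwise one. -/
theorem isTableau_iff {T : Filling} :
    IsTableau T ↔ (∀ R ∈ T, R ≠ []) ∧ (∀ R ∈ T, R.Pairwise (· < ·)) ∧ T.Pairwise Dominates := by
  induction T with
  | nil => simp [IsTableau]
  | cons R T ih =>
    simp only [IsTableau, ih, List.mem_cons, forall_eq_or_imp, List.pairwise_cons]
    constructor
    · rintro ⟨h1, h2, h3, h4, h5, h6⟩
      refine ⟨⟨h1, h4⟩, ⟨h2, h5⟩, ?_, h6⟩
      cases T with
      | nil => simp
      | cons S T =>
        intro S' hS'
        rcases List.mem_cons.1 hS' with rfl | hS'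
        · exact h3
        · exact Dominates.trans h3 ((List.pairwise_cons.1 h6).1 _ hS')
    · rintro ⟨⟨h1, h4⟩, ⟨h2, h5⟩, h3, h6⟩
      refine ⟨h1, h2, ?_, h4, h5, h6⟩
      cases T with
      | nil => exact dominates_nil R
      | cons S T => exact h3 S (by simp)

theorem isStandardTableau_iff {m : ℕ} {T : Filling} :
    IsStandardTableau m T ↔ IsTableau T ∧ T.flatten.Perm (List.range' 1 m) := by
  rw [isTableau_iff]
  constructor
  · rintro ⟨h1, h2, h3, h4, h5⟩
    refine ⟨⟨h1, h3, ?_⟩, h5⟩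
    rw [shape, List.pairwise_map] at h2
    exact (h2.and h4).imp fun h => h
  · rintro ⟨⟨h1, h3, h4⟩, h5⟩
    refine ⟨h1, ?_, h3, h4.imp fun h => h.2, h5⟩
    rw [shape, List.pairwise_map]
    exact h4.imp fun h => h.1

theorem tableauInsert_perm (x : ℕ) (T : Filling) :
    (tableauInsert x T).1.flatten.Perm (x :: T.flatten) := by
  induction T generalizing x with
  | nil => simp [tableauInsert]
  | cons R T ih =>
    have hp := rowInsert_perm (x := x) (R := R)
    rcases h : rowInsert x R with ⟨R', _ | y⟩
    · simp only [h, Option.toList_none, List.nil_append] at hp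
      simpa [tableauInsert, h] using hp.append_right T.flatten
    · simp only [h, Option.toList_some, List.singleton_append] at hp
      simp only [tableauInsert, h, List.flatten_cons]
      refine ((ih y).append_left R').trans ?_
      refine List.perm_middle.trans ?_
      simpa using hp.append_right T.flatten

theorem tableauInsert_headD (x : ℕ) (T : Filling) :
    (tableauInsert x T).1.headD [] = (rowInsert x (T.headD [])).1 := by
  cases T with
  | nil => simp [tableauInsert, rowInsert]
  | cons R T => rcases h : rowInsert x R with ⟨R', _ | y⟩ <;> simp [tableauInsert, h]

theorem IsTableau.headD_pairwise {T : Filling} (h : IsTableau T) :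
    (T.headD []).Pairwise (· < ·) := by
  cases T with
  | nil => simp
  | cons R T => exact h.2.1

theorem headD_subset_flatten {T : Filling} {x : ℕ} (h : x ∈ T.headD []) : x ∈ T.flatten := by
  cases T with
  | nil => simp at h
  | cons R T => simp at h ⊢; exact Or.inl h

/-- The bumped entry `y` moves weakly to the left: if the lower row has a column `i`, its entry
there exceeds `y`, so `y` lands in a column at most `i`. Above it then stands `x` or an entry
smaller than `x`, and `x < y`. -/
theorem Dominates.rowInsert_set {R S : List ℕ} {i x y : ℕ} (h : Dominates R S)
    (hR : R.Pairwise (· < ·)) (hy : R[i]? = some y) (hxy : x < y)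
    (hx : ∀ j a, j < i → R[j]? = some a → a < x) (hyS : y ∉ S) :
    Dominates (R.set i x) (rowInsert y S).1 := by
  rw [pairwise_lt_iff_getElem?] at hR
  obtain ⟨hlen, hcol⟩ := h
  rcases rowInsert_spec y S hyS with ⟨-, h2, h3⟩ | ⟨k, z, -, h2, h3, h4, h5⟩
  · have hSi : S.length ≤ i := by
      by_contra! hc
      have := hcol i y _ hy (List.getElem?_eq_getElem hc)
      have := h3 _ (List.getElem_mem hc)
      omega
    have hi := (List.getElem?_eq_some_iff.1 hy).1
    rw [h2]
    refine ⟨by simp; omega, fun j a b ha hb => ?_⟩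
    simp only [List.getElem?_set, List.getElem?_append] at ha hb
    have k1 := hcol j a b
    have k2 := hR j i a y
    have k3 := hx j a
    clear hR hcol hx h2 h3
    grind
  · have hki : k ≤ i := by
      by_contra! hc
      have hk := (List.getElem?_eq_some_iff.1 h3).1
      have h6 : S[i]? = some S[i] := List.getElem?_eq_getElem (by omega)
      have := hcol i y _ hy h6
      have := h5 i _ hc h6
      omega
    rw [h2]
    refine ⟨by simpa using hlen, fun j a b ha hb => ?_⟩
    simp only [List.getElem?_set] at ha hb
    have k1 := hcol j a b
    have k2 := hcol j y b
    have k3 := hcol j a z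
    have k4 := hR j i a y
    have k5 := hx j a
    clear hR hcol hx h2 h5
    grind

theorem IsTableau.insert {T : Filling} (hT : IsTableau T) {x : ℕ} (hd : (x :: T.flatten).Nodup) :
    IsTableau (tableauInsert x T).1 := by
  induction T generalizing x with
  | nil => simp [tableauInsert, IsTableau, dominates_nil]
  | cons R T ih =>
    obtain ⟨h1, h2, h3, h4⟩ := hT
    have hxR : x ∉ R := by grind
    have hp := rowInsert_pairwise h2 hxR
    rcases rowInsert_spec x R hxR with ⟨e1, e2, h5⟩ | ⟨i, y, e1, e2, h5, h6, h7⟩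
    · have e : rowInsert x R = (R ++ [x], none) := by rw [← e1, ← e2]
      simp only [tableauInsert, e]
      rw [e] at hp
      refine ⟨by simp, hp, ⟨by have := h3.1; rw [List.length_append]; omega, fun j a b ha hb => ?_⟩, h4⟩
      have hj := (List.getElem?_eq_some_iff.1 hb).1
      rw [List.getElem?_append_left (hj.trans_le h3.1)] at ha
      exact h3.2 j a b ha hb
    · have e : rowInsert x R = (R.set i x, some y) := by rw [← e1, ← e2]
      simp only [tableauInsert, e]
      rw [e] at hp
      have hyR : y ∈ R := List.mem_of_getElem? h5
      have hd' : (y :: T.flatten).Nodup := by grind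
      refine ⟨by simpa using h1, hp, ?_, ih h4 hd'⟩
      rw [tableauInsert_headD]
      refine h3.rowInsert_set h2 h5 h6 h7 fun h => ?_
      exact (List.nodup_cons.1 hd').1 (headD_subset_flatten h)

/-- A bump can be undone from the new row and the bumped entry `y`: the changed position is the last
one with an entry below `y`, because everything to its right was already larger than `y`. -/
theorem eq_of_set_eq_set {R S : List ℕ} {i j x x' y : ℕ} (hR : R.Pairwise (· < ·))
    (hS : S.Pairwise (· < ·)) (hRi : R[i]? = some y) (hSj : S[j]? = some y)
    (hx : x < y) (hx' : x' < y) (h : R.set i x = S.set j x') :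
    x = x' ∧ R = S := by
  have key : ∀ k : ℕ, (R.set i x)[k]? = (S.set j x')[k]? := fun k => by rw [h]
  rw [pairwise_lt_iff_getElem?] at hR hS
  have hi := (List.getElem?_eq_some_iff.1 hRi).1
  have hj := (List.getElem?_eq_some_iff.1 hSj).1
  simp only [List.getElem?_set] at key
  have hij : i = j := by
    rcases lt_trichotomy i j with hlt | rfl | hlt
    · have := key j
      grind
    · rfl
    · have := key i
      grind
  subst hij
  have hxx : x = x' := by have := key i; grind
  refine ⟨hxx, List.ext_getElem? fun k => ?_⟩
  have := key k
  grind

theorem IsTableau.eq_nil_of_headD {T : Filling} (h : IsTableau T) (h' : T.headD [] = []) :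
    T = [] := by
  cases T with
  | nil => rfl
  | cons R T => exact absurd h' h.1

/-- The index of the new box tells whether the first row was extended (`0`) or bumped (a successor).
In the latter case induction on the lower rows recovers the bumped entry, and `eq_of_set_eq_set` the
first row. -/
theorem tableauInsert_injective {T T' : Filling} (hT : IsTableau T) (hT' : IsTableau T')
    {x x' : ℕ} (hd : (x :: T.flatten).Nodup) (hd' : (x' :: T'.flatten).Nodup)
    (h : tableauInsert x T = tableauInsert x' T') : x = x' ∧ T = T' := by
  induction T generalizing x x' T' with
  | nil =>
    cases T' with
    | nil => simpa [tableauInsert] using h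
    | cons R' T' =>
      exfalso
      have h1 := hT'.1
      rcases rowInsert_spec x' R' (by grind) with ⟨e1, e2, -⟩ | ⟨i, y, e1, e2, -⟩
      · have e : rowInsert x' R' = (R' ++ [x'], none) := by rw [← e1, ← e2]
        simp [tableauInsert, e, List.singleton_eq_append_iff, h1] at h
      · have e : rowInsert x' R' = (R'.set i x', some y) := by rw [← e1, ← e2]
        simp [tableauInsert, e] at h
  | cons R T ih =>
    obtain ⟨h1, h2, h3, h4⟩ := hT
    cases T' with
    | nil =>
      exfalso
      rcases rowInsert_spec x R (by grind) with ⟨e1, e2, -⟩ | ⟨i, y, e1, e2, -⟩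
      · have e : rowInsert x R = (R ++ [x], none) := by rw [← e1, ← e2]
        simp [tableauInsert, e, List.append_eq_singleton_iff, h1] at h
      · have e : rowInsert x R = (R.set i x, some y) := by rw [← e1, ← e2]
        simp [tableauInsert, e] at h
    | cons R' T' =>
      obtain ⟨h1', h2', h3', h4'⟩ := hT'
      rcases rowInsert_spec x R (by grind) with ⟨e1, e2, -⟩ | ⟨i, y, e1, e2, h5, h6, h7⟩ <;>
      rcases rowInsert_spec x' R' (by grind) with
        ⟨e1', e2', -⟩ | ⟨i', y', e1', e2', h5', h6', h7'⟩
      · have e : rowInsert x R = (R ++ [x], none) := by rw [← e1, ← e2]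
        have e' : rowInsert x' R' = (R' ++ [x'], none) := by rw [← e1', ← e2']
        simp only [tableauInsert, e, e', Prod.mk.injEq, List.cons.injEq] at h
        have := List.append_inj' h.1.1 rfl
        simp_all
      · have e : rowInsert x R = (R ++ [x], none) := by rw [← e1, ← e2]
        have e' : rowInsert x' R' = (R'.set i' x', some y') := by rw [← e1', ← e2']
        simp [tableauInsert, e, e'] at h
      · have e : rowInsert x R = (R.set i x, some y) := by rw [← e1, ← e2]
        have e' : rowInsert x' R' = (R' ++ [x'], none) := by rw [← e1', ← e2']
        simp [tableauInsert, e, e'] at h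
      · have e : rowInsert x R = (R.set i x, some y) := by rw [← e1, ← e2]
        have e' : rowInsert x' R' = (R'.set i' x', some y') := by rw [← e1', ← e2']
        simp only [tableauInsert, e, e', Prod.mk.injEq, List.cons.injEq, Nat.add_right_cancel_iff]
          at h
        obtain ⟨⟨ha, hb⟩, hc⟩ := h
        have hy : y ∈ R := List.mem_of_getElem? h5
        have hy' : y' ∈ R' := List.mem_of_getElem? h5'
        obtain ⟨rfl, rfl⟩ := ih h4 h4' (x := y) (x' := y') (by grind) (by grind)
          (Prod.ext hb hc)
        obtain ⟨rfl, rfl⟩ := eq_of_set_eq_set h2 h2' h5 h5' h6 h6' ha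
        exact ⟨rfl, rfl⟩

/-- The last box of row `k` can be removed from the shape `l`. -/
def IsCorner : ℕ → List ℕ → Prop
  | _, [] => False
  | 0, a :: l => l.headD 0 < a
  | k + 1, _ :: l => IsCorner k l

theorem shape_headD (T : Filling) : (shape T).headD 0 = (T.headD []).length := by
  cases T <;> simp [shape]

/-- One step of reverse bumping. The entry of `R` above `y` is smaller than `y`, so `R` has entries
below `y`; the rightmost of them, `x` in column `i`, must have bumped `y`. Since `i` is at least the
column of `y` in the lower row, `S` has in column `i` no entry or one larger than `y`, and `y` may
return there. -/
theorem Dominates.of_rowInsert {R S : List ℕ} {y : ℕ}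
    (hS : S.Pairwise (· < ·)) (hyS : y ∉ S) (hyR : y ∉ R) (h : Dominates R (rowInsert y S).1) :
    ∃ i x, R[i]? = some x ∧ x < y ∧ (∀ j a, i < j → R[j]? = some a → y < a) ∧
      Dominates (R.set i y) S := by
  obtain ⟨hlen, hcol⟩ := h
  rw [pairwise_lt_iff_getElem?] at hS
  have hmem : y ∈ (rowInsert y S).1 := by
    rcases rowInsert_spec y S hyS with ⟨-, h2, -⟩ | ⟨k, z, -, h2, h3, -⟩
    · rw [h2]; simp
    · rw [h2]; exact List.mem_set (List.getElem?_eq_some_iff.1 h3).1 y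
  obtain ⟨p, hp⟩ := List.mem_iff_getElem?.1 hmem
  have hpR : p < R.length := (List.getElem?_eq_some_iff.1 hp).1.trans_le hlen
  have hpy := hcol p _ y (List.getElem?_eq_getElem hpR) hp
  obtain ⟨i, hi⟩ : ∃ i, IsGreatest {i | ∃ x, R[i]? = some x ∧ x < y} i := by
    have hfin : {i | ∃ x, R[i]? = some x ∧ x < y}.Finite :=
      (Set.finite_lt_nat R.length).subset fun i ⟨x, hx, _⟩ => (List.getElem?_eq_some_iff.1 hx).1
    exact ⟨_, hfin.isCompact.isGreatest_sSup ⟨p, _, List.getElem?_eq_getElem hpR, hpy⟩⟩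
  obtain ⟨⟨x, hx, hxy⟩, hmax⟩ := hi
  have hpi : p ≤ i := hmax ⟨_, List.getElem?_eq_getElem hpR, hpy⟩
  have hgt : ∀ j a, i < j → R[j]? = some a → y < a := by
    intro j a hj ha
    by_contra! hc
    have hya : a ≠ y := fun h => hyR (h ▸ List.mem_of_getElem? ha)
    have := hmax ⟨a, ha, by omega⟩
    omega
  refine ⟨i, x, hx, hxy, hgt, ?_⟩
  have hxi := (List.getElem?_eq_some_iff.1 hx).1
  rcases rowInsert_spec y S hyS with ⟨-, h2, h3⟩ | ⟨k, z, -, h2, h3, h4, h5⟩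
  · rw [h2] at hlen hcol hp
    have hpS : p = S.length := by
      by_contra hc
      rw [List.getElem?_append] at hp
      split at hp
      · exact hyS (List.mem_of_getElem? hp)
      · grind
    rw [List.length_append] at hlen
    refine ⟨by simp; omega, fun j a b ha hb => ?_⟩
    have hj := (List.getElem?_eq_some_iff.1 hb).1
    rw [List.getElem?_set_ne (by omega)] at ha
    exact hcol j a b ha (by rw [List.getElem?_append_left hj, hb])
  · rw [h2] at hlen hcol hp
    rw [List.length_set] at hlen
    have hkS := (List.getElem?_eq_some_iff.1 h3).1
    have hpk : p = k := by
      by_contra hc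
      rw [List.getElem?_set_ne (by omega)] at hp
      exact hyS (List.mem_of_getElem? hp)
    subst hpk
    refine ⟨by simpa using hlen, fun j a b ha hb => ?_⟩
    have hc := hcol j
    simp only [List.getElem?_set] at ha hc
    have k1 := hc a b
    have k2 := hS p j z b
    clear hmax hS hcol hgt h5 hc
    grind

/-- Reverse insertion: a corner in the first row is simply removed. Otherwise the insertion into the
lower rows is undone first, and the entry `y` it releases is pushed back into the first row,
releasing `x`. -/
theorem exists_tableauInsert_eq {T' : Filling} {k : ℕ} (hT' : IsTableau T')
    (hd : T'.flatten.Nodup) (hk : IsCorner k (shape T')) :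
    ∃ T x, IsTableau T ∧ tableauInsert x T = (T', k) := by
  induction T' generalizing k with
  | nil => simp [shape, IsCorner] at hk
  | cons R' T' ih =>
    obtain ⟨h1, h2, h3, h4⟩ := hT'
    cases k with
    | zero =>
      have hlen : (T'.headD []).length < R'.length := by
        rw [← shape_headD]; simpa [shape, IsCorner] using hk
      obtain ⟨R, z, rfl⟩ := (List.eq_nil_or_concat' R').resolve_left h1
      rw [List.pairwise_append] at h2
      have h5 : ∀ a ∈ R, a < z := fun a ha => h2.2.2 a ha z (by simp)
      rw [List.length_append, List.length_singleton] at hlen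
      -- A row of length one disappears altogether, as empty rows are not listed; it must then have
      -- been the only row.
      by_cases hR : R = []
      · subst hR
        obtain rfl : T' = [] := h4.eq_nil_of_headD (List.length_eq_zero_iff.1 (by simpa using hlen))
        exact ⟨[], z, trivial, by simp [tableauInsert]⟩
      · refine ⟨R :: T', z, ⟨hR, h2.1, ⟨by omega, fun j a b ha hb => h3.2 j a b ?_ hb⟩, h4⟩, ?_⟩
        · rw [List.getElem?_append_left (List.getElem?_eq_some_iff.1 ha).1, ha]
        · rw [tableauInsert, rowInsert_eq_append h5]
    | succ k =>
      obtain ⟨T, y, hT, hins⟩ := ih h4 (by grind) hk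
      have hperm := tableauInsert_perm y T
      rw [hins] at hperm
      have hnd : (y :: T.flatten).Nodup := hperm.nodup_iff.1 (by grind)
      have hyT : y ∉ T.headD [] := fun h => (List.nodup_cons.1 hnd).1 (headD_subset_flatten h)
      have hyT' : y ∈ T'.flatten := hperm.mem_iff.2 (by simp)
      have hyR : y ∉ R' := by
        intro h
        rw [List.flatten_cons, List.nodup_append] at hd
        exact hd.2.2 y h y hyT' rfl
      have hhead := tableauInsert_headD y T
      rw [hins] at hhead
      simp only at hhead
      rw [hhead] at h3
      obtain ⟨i, x, hx, hxy, hgt, hdom⟩ := h3.of_rowInsert hT.headD_pairwise hyT hyR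
      have hi := (List.getElem?_eq_some_iff.1 hx).1
      have h2' := pairwise_lt_iff_getElem?.1 h2
      refine ⟨R'.set i y :: T, x, ⟨by simpa using h1, ?_, hdom, hT⟩, ?_⟩
      · rw [pairwise_lt_iff_getElem?]
        intro a b u v hab hu hv
        simp only [List.getElem?_set] at hu hv
        grind
      · have e : rowInsert x (R'.set i y) = ((R'.set i y).set i x, some y) := by
          apply rowInsert_eq_set _ hxy
          · intro j a hj ha
            rw [List.getElem?_set_ne (by omega)] at ha
            exact h2' j i a x hj ha hx
          · simp [hi]
        have hset : (R'.set i y).set i x = R' := by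
          rw [List.set_set]
          exact List.ext_getElem? fun j => by rw [List.getElem?_set]; grind
        simp [tableauInsert, e, hset, hins]

/-- Add a box to row `k` of a shape. -/
def addShapeBox : ℕ → List ℕ → List ℕ
  | _, [] => [1]
  | 0, a :: l => (a + 1) :: l
  | k + 1, a :: l => a :: addShapeBox k l

theorem shape_addBox (x k : ℕ) (T : Filling) : shape (addBox x k T) = addShapeBox k (shape T) := by
  induction T generalizing k with
  | nil => simp [addBox, shape, addShapeBox]
  | cons R T ih =>
    cases k with
    | zero => simp [addBox, shape, addShapeBox]
    | succ k =>
      have := ih k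
      simp only [shape] at this
      simp [addBox, shape, addShapeBox, this]

theorem shape_tableauInsert {x : ℕ} {T : Filling} (hd : (x :: T.flatten).Nodup) :
    shape (tableauInsert x T).1 = addShapeBox (tableauInsert x T).2 (shape T) ∧
      (tableauInsert x T).2 ≤ T.length := by
  induction T generalizing x with
  | nil => simp [tableauInsert, shape, addShapeBox]
  | cons R T ih =>
    rcases rowInsert_spec x R (by grind) with ⟨e1, e2, -⟩ | ⟨i, y, e1, e2, h5, -⟩
    · have e : rowInsert x R = (R ++ [x], none) := by rw [← e1, ← e2]
      simp [tableauInsert, e, shape, addShapeBox]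
    · have e : rowInsert x R = (R.set i x, some y) := by rw [← e1, ← e2]
      have hy : y ∈ R := List.mem_of_getElem? h5
      have := ih (x := y) (by grind)
      simp only [shape] at this
      simp [tableauInsert, e, shape, addShapeBox, this]

theorem addShapeBox_nil (k : ℕ) : addShapeBox k [] = [1] := by cases k <;> rfl

theorem addShapeBox_ne_nil (k : ℕ) (l : List ℕ) : addShapeBox k l ≠ [] := by
  cases k <;> cases l <;> simp [addShapeBox]

theorem singleton_ne_addShapeBox_cons {k a : ℕ} {l : List ℕ} (ha : a ≠ 0) :
    [1] ≠ addShapeBox k (a :: l) := by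
  cases k with
  | zero => simp [addShapeBox, ha]
  | succ k => simp [addShapeBox, (addShapeBox_ne_nil k l).symm]

/-- Zero parts must be excluded, since `[]` and `[0]` both become `[1]` when a box is added to row
`0`. Empty rows cause the same ambiguity in `addBox_injective`. -/
theorem addShapeBox_injective {k : ℕ} {l l' : List ℕ} (h0 : ∀ a ∈ l, a ≠ 0) (h0' : ∀ a ∈ l', a ≠ 0)
    (h : addShapeBox k l = addShapeBox k l') : l = l' := by
  induction l generalizing k l' with
  | nil =>
    cases l' with
    | nil => rfl
    | cons a l' =>
      rw [addShapeBox_nil] at h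
      exact absurd h (singleton_ne_addShapeBox_cons (h0' a (by simp)))
  | cons a l ih =>
    cases l' with
    | nil =>
      rw [addShapeBox_nil] at h
      exact absurd h.symm (singleton_ne_addShapeBox_cons (h0 a (by simp)))
    | cons b l' =>
      cases k with
      | zero => simpa [addShapeBox] using h
      | succ k =>
        simp only [addShapeBox, List.cons.injEq] at h
        rw [h.1, ih (fun a ha => h0 a (by simp [ha])) (fun a ha => h0' a (by simp [ha])) h.2]

theorem addBox_perm (x k : ℕ) (T : Filling) : (addBox x k T).flatten.Perm (x :: T.flatten) := by
  induction T generalizing k with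
  | nil => simp [addBox]
  | cons R T ih =>
    cases k with
    | zero => simp [addBox]
    | succ k => exact ((ih k).append_left R).trans List.perm_middle

theorem addBox_nil (x k : ℕ) : addBox x k [] = [[x]] := by cases k <;> rfl

theorem addBox_ne_nil (x k : ℕ) (T : Filling) : addBox x k T ≠ [] := by
  cases k <;> cases T <;> simp [addBox]

theorem singleton_ne_addBox_cons {x k : ℕ} {R : List ℕ} {T : Filling} (hR : R ≠ []) :
    [[x]] ≠ addBox x k (R :: T) := by
  cases k with
  | zero => simp [addBox, hR]
  | succ k => simp [addBox, (addBox_ne_nil x k T).symm]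

theorem addBox_injective {x k : ℕ} {T T' : Filling} (h0 : ∀ R ∈ T, R ≠ []) (h0' : ∀ R ∈ T', R ≠ [])
    (h : addBox x k T = addBox x k T') : T = T' := by
  induction T generalizing k T' with
  | nil =>
    cases T' with
    | nil => rfl
    | cons R T' =>
      rw [addBox_nil] at h
      exact absurd h (singleton_ne_addBox_cons (h0' R (by simp)))
  | cons a l ih =>
    cases T' with
    | nil =>
      rw [addBox_nil] at h
      exact absurd h.symm (singleton_ne_addBox_cons (h0 a (by simp)))
    | cons b l' =>
      cases k with
      | zero => simpa [addBox] using h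
      | succ k =>
        simp only [addBox, List.cons.injEq] at h
        rw [h.1, ih (fun a ha => h0 a (by simp [ha])) (fun a ha => h0' a (by simp [ha])) h.2]

/-- For `k` beyond the number of rows, `addBox` would still open only the next row, whence the bound
on `k`. -/
theorem rowOf_addBox_self {x k : ℕ} {T : Filling} (hk : k ≤ T.length) (hx : x ∉ T.flatten) :
    rowOf (addBox x k T) x = k := by
  induction T generalizing k with
  | nil => simp at hk; simp [addBox, rowOf, hk]
  | cons R T ih =>
    cases k with
    | zero => simp [addBox, rowOf, List.findIdx_cons]
    | succ k =>
      have := ih (k := k) (by simpa using hk) (by grind)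
      have hR : x ∉ R := by grind
      simp only [rowOf] at this
      simp [addBox, rowOf, List.findIdx_cons, hR, this]

theorem rowOf_addBox_of_mem {x y k : ℕ} {T : Filling} (hxy : y ≠ x) (hy : y ∈ T.flatten) :
    rowOf (addBox x k T) y = rowOf T y := by
  induction T generalizing k with
  | nil => simp at hy
  | cons R T ih =>
    cases k with
    | zero => simp [addBox, rowOf, List.findIdx_cons, hxy]
    | succ k =>
      by_cases hR : y ∈ R
      · simp [addBox, rowOf, List.findIdx_cons, hR]
      · have := ih (k := k) (by grind)
        simp only [rowOf] at this
        simp [addBox, rowOf, List.findIdx_cons, hR, this]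

theorem IsTableau.addBox {x k : ℕ} {T : Filling} (hT : IsTableau T) (hx : ∀ a ∈ T.flatten, a < x)
    (hs : (shape (addBox x k T)).Pairwise (fun a b => b ≤ a)) : IsTableau (addBox x k T) := by
  induction T generalizing k with
  | nil => simp [PlanarRSK.addBox, IsTableau, dominates_nil]
  | cons R T ih =>
    obtain ⟨h1, h2, h3, h4⟩ := hT
    cases k with
    | zero =>
      refine ⟨by simp, ?_, ⟨by have := h3.1; rw [List.length_append]; omega,
        fun j a b ha hb => ?_⟩, h4⟩
      · rw [List.pairwise_append]
        exact ⟨h2, by simp, fun a ha b hb => by simp at hb; subst hb; exact hx a (by simp [ha])⟩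
      · have hj := (List.getElem?_eq_some_iff.1 hb).1
        rw [List.getElem?_append_left (hj.trans_le h3.1)] at ha
        exact h3.2 j a b ha hb
    | succ k =>
      have hs' : (shape (PlanarRSK.addBox x k T)).Pairwise (fun a b => b ≤ a) :=
        (List.pairwise_cons.1 hs).2
      have hlen : ((PlanarRSK.addBox x k T).headD []).length ≤ R.length := by
        have := (List.pairwise_cons.1 hs).1
        cases hb : PlanarRSK.addBox x k T with
        | nil => simp
        | cons S T'' => rw [hb] at this; exact this _ (by simp)
      refine ⟨h1, h2, ⟨hlen, fun j a b ha hb => ?_⟩, ih h4 (fun a ha => hx a (by grind)) hs'⟩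
      have hax : a < x := hx a (by simp [List.mem_of_getElem? ha])
      cases T with
      | nil => simp [PlanarRSK.addBox] at hb; grind
      | cons S T =>
        have hc := h3.2 j a b ha
        cases k with
        | zero =>
          simp only [PlanarRSK.addBox, List.headD_cons, List.getElem?_append] at hb hc
          grind
        | succ k => exact hc (by simpa [PlanarRSK.addBox] using hb)

/-- The largest entry ends its row, and nothing can stand below it, so it occupies a corner and
removing it leaves a tableau. -/
theorem IsTableau.exists_addBox {x : ℕ} {T' : Filling} (hT' : IsTableau T')
    (hd : T'.flatten.Nodup) (hx : x ∈ T'.flatten) (hmax : ∀ a ∈ T'.flatten, a ≤ x) :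
    ∃ k T, IsTableau T ∧ T' = PlanarRSK.addBox x k T ∧ k ≤ T.length ∧ IsCorner k (shape T') := by
  induction T' with
  | nil => simp at hx
  | cons R T' ih =>
    obtain ⟨h1, h2, h3, h4⟩ := hT'
    by_cases hxR : x ∈ R
    · obtain ⟨R, z, rfl⟩ := (List.eq_nil_or_concat' R).resolve_left h1
      rw [List.pairwise_append] at h2
      have hlast : z = x := by
        have hle : z ≤ x := hmax _ (by simp)
        rw [List.mem_append, List.mem_singleton] at hxR
        rcases hxR with hxR | hxR
        · have := h2.2.2 x hxR _ (List.mem_singleton_self _)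
          omega
        · exact hxR.symm
      subst hlast
      have hlen : (T'.headD []).length < (R ++ [z]).length := by
        rw [List.length_append, List.length_singleton, Nat.lt_succ_iff]
        by_contra! hc
        have hb : (T'.headD [])[R.length]? = some (T'.headD [])[R.length] :=
          List.getElem?_eq_getElem hc
        have := h3.2 R.length z _ (by simp) hb
        have := hmax _ (List.mem_append_right (R ++ [z])
          (headD_subset_flatten (List.mem_of_getElem? hb)))
        omega
      have hcor : IsCorner 0 (shape ((R ++ [z]) :: T')) := by
        rw [← shape_headD] at hlen
        exact hlen
      rw [List.length_append, List.length_singleton] at hlen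
      by_cases hR : R = []
      · subst hR
        obtain rfl : T' = [] := h4.eq_nil_of_headD (List.length_eq_zero_iff.1 (by simpa using hlen))
        exact ⟨0, [], trivial, rfl, by simp, hcor⟩
      · refine ⟨0, R :: T', ⟨hR, h2.1, ⟨by omega, fun j a b ha hb => h3.2 j a b ?_ hb⟩, h4⟩, rfl,
          by simp, hcor⟩
        rw [List.getElem?_append_left (List.getElem?_eq_some_iff.1 ha).1, ha]
    · obtain ⟨k, T, hT, rfl, hk, hcor⟩ := ih h4 (by grind) (by grind) fun a ha => hmax a (by grind)
      refine ⟨k + 1, R :: T, ⟨h1, h2, ?_, hT⟩, rfl, by simpa using hk, hcor⟩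
      cases T with
      | nil => exact dominates_nil R
      | cons S T =>
        cases k with
        | zero =>
          simp only [PlanarRSK.addBox, List.headD_cons] at h3 ⊢
          refine ⟨by have := h3.1; rw [List.length_append] at this; omega,
            fun j a b ha hb => h3.2 j a b ha ?_⟩
          rw [List.getElem?_append_left (List.getElem?_eq_some_iff.1 hb).1, hb]
        | succ k => exact h3

end Tableaux

/-! ### RSK on words is a bijection -/

section RSK

/-- The RSK correspondence for a word which is listed from its last letter to its first. -/
def rskRev : List ℕ → Filling × Filling
  | [] => ([], [])
  | x :: w => ((tableauInsert x (rskRev w).1).1,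
      addBox (w.length + 1) (tableauInsert x (rskRev w).1).2 (rskRev w).2)

/-- The hypothesis on `L` says that it is an initial segment of the positions, so that the label `i
+ 1` used by the fold is the length of the word read so far, as in `rskRev`. -/
theorem rsk_foldl_eq_rskRev {m : ℕ} (π : Equiv.Perm (Fin m)) (L : List (Fin m))
    (hL : L.map Fin.val = List.range L.length) :
    L.foldl (fun PQ i =>
      ((tableauInsert (π i + 1) PQ.1).1,
        addBox (i + 1) (tableauInsert (π i + 1) PQ.1).2 PQ.2)) ([], []) =
      rskRev (L.map fun i => (π i : ℕ) + 1).reverse := by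
  induction L using List.reverseRecOn with
  | nil => rfl
  | append_singleton L i ih =>
    rw [List.map_append, List.length_append, List.length_singleton, List.range_succ] at hL
    obtain ⟨h1, h2⟩ := List.append_inj' hL rfl
    rw [List.foldl_append, ih h1]
    simp only [List.map_cons, List.map_nil, List.cons.injEq, and_true] at h2
    simp [rskRev, h2]

theorem rsk_eq_rskRev {m : ℕ} (π : Equiv.Perm (Fin m)) :
    rsk π = rskRev ((List.finRange m).map fun i => (π i : ℕ) + 1).reverse :=
  rsk_foldl_eq_rskRev π _ (by simp)

theorem IsTableau.shape_pairwise {T : Filling} (h : IsTableau T) :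
    (shape T).Pairwise (fun a b => b ≤ a) := by
  rw [shape, List.pairwise_map]
  exact (isTableau_iff.1 h).2.2.imp fun h => h.1

theorem IsTableau.ne_nil {T : Filling} (h : IsTableau T) : ∀ R ∈ T, R ≠ [] :=
  (isTableau_iff.1 h).1

theorem IsTableau.shape_ne_zero {T : Filling} (h : IsTableau T) : ∀ a ∈ shape T, a ≠ 0 := by
  intro a ha
  obtain ⟨R, hR, rfl⟩ := List.mem_map.1 ha
  simpa using h.ne_nil R hR

theorem length_eq_of_shape_eq {T T' : Filling} (h : shape T = shape T') : T.length = T'.length := by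
  simpa [shape] using congrArg List.length h

theorem rskRev_spec {w : List ℕ} (hw : w.Nodup) :
    IsTableau (rskRev w).1 ∧ (rskRev w).1.flatten.Perm w ∧ IsTableau (rskRev w).2 ∧
      (rskRev w).2.flatten.Perm (List.range' 1 w.length) ∧
      shape (rskRev w).1 = shape (rskRev w).2 := by
  induction w with
  | nil => simp [rskRev, IsTableau]
  | cons x w ih =>
    obtain ⟨h1, h2, h3, h4, h5⟩ := ih (List.nodup_cons.1 hw).2
    have hnd : (x :: (rskRev w).1.flatten).Nodup := (h2.cons x).nodup_iff.2 hw
    have hP := h1.insert hnd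
    have hs : shape (rskRev (x :: w)).1 = shape (rskRev (x :: w)).2 := by
      rw [rskRev, shape_addBox, (shape_tableauInsert hnd).1, h5]
    refine ⟨hP, (tableauInsert_perm _ _).trans (h2.cons x), ?_, ?_, hs⟩
    -- The new label exceeds all earlier ones, so only the shape of the recording tableau could go
    -- wrong, and it is the shape of the insertion tableau.
    · refine h3.addBox (fun a ha => ?_) ?_
      · have := h4.mem_iff.1 ha
        simp at this
        omega
      · have := hP.shape_pairwise
        exact hs ▸ this
    · rw [List.length_cons, List.range'_1_concat]
      refine (addBox_perm _ _ _).trans ((h4.cons _).trans ?_)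
      rw [Nat.add_comm]
      exact (List.perm_append_singleton _ _).symm

theorem rskRev_snd_notMem {w : List ℕ} (hw : w.Nodup) {k : ℕ} (hk : w.length < k) :
    k ∉ (rskRev w).2.flatten := by
  intro h
  have := (rskRev_spec hw).2.2.2.1.mem_iff.1 h
  simp at this
  omega

theorem tableauInsert_snd_le {x : ℕ} {w : List ℕ} (hw : (x :: w).Nodup) :
    (tableauInsert x (rskRev w).1).2 ≤ (rskRev w).2.length := by
  obtain ⟨h1, h2, h3, h4, h5⟩ := rskRev_spec (List.nodup_cons.1 hw).2
  rw [← length_eq_of_shape_eq h5]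
  exact (shape_tableauInsert ((h2.cons x).nodup_iff.2 hw)).2

/-- The row of the largest label in the recording tableau is the row where the last insertion ended.
This makes the last insertion reversible, and induction applies to the shorter words. -/
theorem rskRev_injective {w w' : List ℕ} (hw : w.Nodup) (hw' : w'.Nodup)
    (h : rskRev w = rskRev w') : w = w' := by
  have hlen : w.length = w'.length := by
    rw [← (rskRev_spec hw).2.1.length_eq, ← (rskRev_spec hw').2.1.length_eq, h]
  induction w generalizing w' with
  | nil => exact (List.length_eq_zero_iff.1 hlen.symm).symm
  | cons x w ih =>
    cases w' with
    | nil => simp at hlen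
    | cons x' w' =>
      have hl : w.length = w'.length := by simpa using hlen
      obtain ⟨h1, h2, h3, -, -⟩ := rskRev_spec (List.nodup_cons.1 hw).2
      obtain ⟨h1', h2', h3', -, -⟩ := rskRev_spec (List.nodup_cons.1 hw').2
      simp only [rskRev, Prod.mk.injEq, hl] at h
      obtain ⟨hP, hQ⟩ := h
      have hk : (tableauInsert x (rskRev w).1).2 = (tableauInsert x' (rskRev w').1).2 := by
        have := congrArg (fun T => rowOf T (w'.length + 1)) hQ
        rwa [rowOf_addBox_self (tableauInsert_snd_le hw)
            (rskRev_snd_notMem (List.nodup_cons.1 hw).2 (by omega)),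
          rowOf_addBox_self (tableauInsert_snd_le hw')
            (rskRev_snd_notMem (List.nodup_cons.1 hw').2 (by omega))] at this
      rw [hk] at hQ
      obtain ⟨rfl, hP'⟩ := tableauInsert_injective h1 h1' ((h2.cons x).nodup_iff.2 hw)
        ((h2'.cons x').nodup_iff.2 hw') (Prod.ext hP hk)
      rw [ih (List.nodup_cons.1 hw).2 (List.nodup_cons.1 hw').2
        (Prod.ext hP' (addBox_injective h3.ne_nil h3'.ne_nil hQ)) hl]

theorem IsTableau.eq_nil_of_flatten {T : Filling} (h : IsTableau T) (h' : T.flatten = []) :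
    T = [] := by
  cases T with
  | nil => rfl
  | cons R T => exact absurd (by simp at h'; exact h'.1) h.1

theorem exists_rskRev_eq {m : ℕ} {P Q : Filling} (hP : IsTableau P) (hd : P.flatten.Nodup)
    (hQ : IsTableau Q) (hQm : Q.flatten.Perm (List.range' 1 m)) (hs : shape P = shape Q) :
    ∃ w : List ℕ, w.Nodup ∧ rskRev w = (P, Q) := by
  induction m generalizing P Q with
  | zero =>
    obtain rfl : Q = [] := hQ.eq_nil_of_flatten (by simpa using hQm)
    obtain rfl : P = [] := List.length_eq_zero_iff.1 (length_eq_of_shape_eq hs)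
    exact ⟨[], by simp, rfl⟩
  | succ m ih =>
    obtain ⟨k, Q, hQ0, rfl, hk, hcor⟩ := hQ.exists_addBox (x := m + 1)
      (hQm.nodup_iff.2 List.nodup_range') (hQm.mem_iff.2 (by simp))
      (fun a ha => by have := hQm.mem_iff.1 ha; simp at this; omega)
    rw [← hs] at hcor
    obtain ⟨P0, x, hP0, hins⟩ := exists_tableauInsert_eq hP hd hcor
    have hperm := tableauInsert_perm x P0
    rw [hins] at hperm
    have hnd := hperm.nodup_iff.1 hd
    have hs0 : shape P0 = shape Q := by
      refine addShapeBox_injective (k := k) hP0.shape_ne_zero hQ0.shape_ne_zero ?_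
      have := (shape_tableauInsert hnd).1
      rw [hins] at this
      rw [← this, ← shape_addBox (m + 1), hs]
    have hQm0 : Q.flatten.Perm (List.range' 1 m) := by
      have h1 := (addBox_perm (m + 1) k Q).symm.trans hQm
      rw [List.range'_1_concat, Nat.add_comm 1 m] at h1
      exact (h1.trans (List.perm_append_singleton _ _)).cons_inv
    obtain ⟨w, hw, hrsk⟩ := ih hP0 (List.nodup_cons.1 hnd).2 hQ0 hQm0 hs0
    have hlen : w.length = m := by
      have h1 := (rskRev_spec hw).2.2.2.1
      rw [hrsk] at h1
      simpa using h1.symm.length_eq.trans hQm0.length_eq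
    have hPw := (rskRev_spec hw).2.1
    rw [hrsk] at hPw
    refine ⟨x :: w, (hPw.cons x).nodup_iff.1 hnd, ?_⟩
    rw [rskRev, hrsk, hlen, hins]

end RSK

/-! ### Row comparisons in `Q` and `P` as descents of `π` and of its inverse -/

section Descents

theorem nodup_cons_cons_flatten {x x' : ℕ} {R : List ℕ} {T : Filling}
    (hd : (x' :: x :: (R :: T).flatten).Nodup) :
    x ∉ R ∧ x' ∉ R ∧ x' ≠ x ∧ x ∉ T.flatten ∧ x' ∉ T.flatten ∧ T.flatten.Nodup ∧
      ∀ a ∈ R, a ∉ T.flatten := by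
  simp only [List.nodup_cons, List.flatten_cons, List.mem_cons, List.mem_append,
    List.nodup_append, not_or] at hd
  obtain ⟨⟨h1, h2, h3⟩, ⟨h4, h5⟩, h6, h7, h8⟩ := hd
  exact ⟨h4, h2, h1, h5, h3, h7, fun a ha ha' => h8 a ha a ha' rfl⟩

/-- In each row the second insertion acts strictly to the right of the first, so the bumped entries
are again in increasing order. As soon as the first insertion ends in a row, the second can be
appended there too. -/
theorem tableauInsert_snd_le_of_lt {T : Filling} (hT : IsTableau T) {x x' : ℕ}
    (hd : (x' :: x :: T.flatten).Nodup) (h : x < x') :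
    (tableauInsert x' (tableauInsert x T).1).2 ≤ (tableauInsert x T).2 := by
  induction T generalizing x x' with
  | nil =>
    have : ¬ x' < x := by omega
    simp [tableauInsert, rowInsert, this]
  | cons R T ih =>
    obtain ⟨h1, h2, h3, h4⟩ := hT
    have h2' := pairwise_lt_iff_getElem?.1 h2
    obtain ⟨hxR, hxR', hxx, hxT, hxT', hTd, hRT⟩ := nodup_cons_cons_flatten hd
    rcases rowInsert_spec x R hxR with ⟨e1, e2, h5⟩ | ⟨i, y, e1, e2, h5, h6, h7⟩
    · have e : rowInsert x R = (R ++ [x], none) := by rw [← e1, ← e2]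
      have e' : rowInsert x' (R ++ [x]) = (R ++ [x] ++ [x'], none) := by
        apply rowInsert_eq_append
        intro a ha
        rw [List.mem_append, List.mem_singleton] at ha
        rcases ha with ha | rfl
        · exact (h5 a ha).trans h
        · exact h
      simp [tableauInsert, e, e']
    · have e : rowInsert x R = (R.set i x, some y) := by rw [← e1, ← e2]
      have hy : y ∈ R := List.mem_of_getElem? h5
      rcases rowInsert_spec x' (R.set i x)
          (fun h => (List.mem_or_eq_of_mem_set h).elim hxR' hxx) with
        ⟨e1', e2', h5'⟩ | ⟨i', y', e1', e2', h5', h6', h7'⟩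
      · have e' : rowInsert x' (R.set i x) = (R.set i x ++ [x'], none) := by rw [← e1', ← e2']
        simp [tableauInsert, e, e']
      · have e' : rowInsert x' (R.set i x) = ((R.set i x).set i' x', some y') := by
          rw [← e1', ← e2']
        have hi : i < R.length := (List.getElem?_eq_some_iff.1 h5).1
        have hii : i < i' := by
          by_contra! hc
          rcases hc.lt_or_eq with hc | rfl
          · rw [List.getElem?_set_ne (by omega)] at h5'
            have := h7 i' y' hc h5'
            omega
          · simp [hi] at h5'
            omega
        rw [List.getElem?_set_ne (by omega)] at h5'
        have hyy := h2' i i' y y' hii h5 h5'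
        have hy' : y' ∈ R := List.mem_of_getElem? h5'
        have hnd : (y' :: y :: T.flatten).Nodup := by
          simp [hyy.ne', hRT y hy, hRT y' hy', hTd]
        have := ih h4 hnd hyy
        simpa [tableauInsert, e, e'] using this

/-- The second insertion acts weakly to the left of the first and bumps some `y' ≤ x < y`, so the
order stays decreasing. In the row where the first insertion ends, the second still has to bump, and
so continues further down. -/
theorem lt_tableauInsert_snd_of_lt {T : Filling} (hT : IsTableau T) {x x' : ℕ}
    (hd : (x' :: x :: T.flatten).Nodup) (h : x' < x) :
    (tableauInsert x T).2 < (tableauInsert x' (tableauInsert x T).1).2 := by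
  induction T generalizing x x' with
  | nil => simp [tableauInsert, rowInsert, h]
  | cons R T ih =>
    obtain ⟨h1, h2, h3, h4⟩ := hT
    have h2' := pairwise_lt_iff_getElem?.1 h2
    obtain ⟨hxR, hxR', hxx, hxT, hxT', hTd, hRT⟩ := nodup_cons_cons_flatten hd
    rcases rowInsert_spec x R hxR with ⟨e1, e2, h5⟩ | ⟨i, y, e1, e2, h5, h6, h7⟩
    · have e : rowInsert x R = (R ++ [x], none) := by rw [← e1, ← e2]
      rcases rowInsert_spec x' (R ++ [x]) (by simp [hxR', hxx]) with
        ⟨e1', e2', h5'⟩ | ⟨i', y', e1', e2', h5', h6', h7'⟩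
      · have := h5' x (by simp)
        omega
      · have e' : rowInsert x' (R ++ [x]) = ((R ++ [x]).set i' x', some y') := by
          rw [← e1', ← e2']
        simp [tableauInsert, e, e']
    · have e : rowInsert x R = (R.set i x, some y) := by rw [← e1, ← e2]
      have hy : y ∈ R := List.mem_of_getElem? h5
      have hi : i < R.length := (List.getElem?_eq_some_iff.1 h5).1
      rcases rowInsert_spec x' (R.set i x)
          (fun h => (List.mem_or_eq_of_mem_set h).elim hxR' hxx) with
        ⟨e1', e2', h5'⟩ | ⟨i', y', e1', e2', h5', h6', h7'⟩
      · have := h5' x (List.mem_set hi x)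
        omega
      · have e' : rowInsert x' (R.set i x) = ((R.set i x).set i' x', some y') := by
          rw [← e1', ← e2']
        have hii : i' ≤ i := by
          by_contra! hc
          have := h7' i x hc (by simp [hi])
          omega
        have hyy : y' ≤ x := by
          rcases hii.lt_or_eq with hc | rfl
          · rw [List.getElem?_set_ne (by omega)] at h5'
            exact (h7 i' y' hc h5').le
          · simp [hi] at h5'
            omega
        have hy' : y' = x ∨ y' ∈ R := (List.mem_or_eq_of_mem_set (List.mem_of_getElem? h5')).symm
        have hyT : y' ∉ T.flatten := by
          rcases hy' with rfl | hy'
          · exact hxT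
          · exact hRT y' hy'
        have hlt : y' < y := by omega
        have hnd : (y' :: y :: T.flatten).Nodup := by
          simp [hlt.ne, hRT y hy, hyT, hTd]
        have := ih h4 hnd hlt
        simpa [tableauInsert, e, e'] using this

/-- The word is listed backwards, so `a` is inserted right after the letters of `C`, and `b` right
after `a`. The letters of `A` only add boxes with larger labels and move no existing one. -/
theorem rowOf_rskRev_snd_lt_iff {A C : List ℕ} {a b : ℕ} (hd : (A ++ b :: a :: C).Nodup) :
    rowOf (rskRev (A ++ b :: a :: C)).2 (C.length + 1) <
      rowOf (rskRev (A ++ b :: a :: C)).2 (C.length + 2) ↔ b < a := by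
  induction A with
  | nil =>
    rw [List.nil_append] at hd ⊢
    have hd' := (List.nodup_cons.1 hd).2
    have hC := (List.nodup_cons.1 hd').2
    obtain ⟨h1, h2, h3, -, -⟩ := rskRev_spec hC
    have hnd : (b :: a :: (rskRev C).1.flatten).Nodup :=
      ((h2.cons a).cons b).nodup_iff.2 hd
    have e1 : rowOf (rskRev (b :: a :: C)).2 (C.length + 2) =
        (tableauInsert b (rskRev (a :: C)).1).2 := by
      have := tableauInsert_snd_le hd
      rw [rskRev]
      exact rowOf_addBox_self this (rskRev_snd_notMem hd' (by simp))
    have e2 : rowOf (rskRev (b :: a :: C)).2 (C.length + 1) = (tableauInsert a (rskRev C).1).2 := by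
      rw [rskRev, rowOf_addBox_of_mem (by simp)]
      · exact rowOf_addBox_self (tableauInsert_snd_le hd') (rskRev_snd_notMem hC (by simp))
      · exact (rskRev_spec hd').2.2.2.1.mem_iff.2 (by simp)
    rw [e1, e2, rskRev]
    constructor
    · intro h
      by_contra! hc
      have hab : a ≠ b := by grind
      exact (tableauInsert_snd_le_of_lt h1 hnd (by omega)).not_gt h
    · exact lt_tableauInsert_snd_of_lt h1 hnd
  | cons x A ih =>
    have hd' := (List.nodup_cons.1 hd).2
    have hmem : ∀ k, 1 ≤ k → k ≤ C.length + 2 →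
        rowOf (rskRev (x :: (A ++ b :: a :: C))).2 k = rowOf (rskRev (A ++ b :: a :: C)).2 k := by
      intro k hk1 hk2
      rw [rskRev, rowOf_addBox_of_mem (by simp; omega)]
      exact (rskRev_spec hd').2.2.2.1.mem_iff.2 (by simp; omega)
    rw [List.cons_append, hmem _ (by omega) (by omega), hmem _ (by omega) (by omega)]
    exact ih hd'

/-- Some occurrence of `a` in the word stands before some occurrence of `b`. -/
def Before (a b : ℕ) : List ℕ → Prop
  | [] => False
  | c :: w => (c = a ∧ b ∈ w) ∨ Before a b w

theorem before_append {a b : ℕ} {u v : List ℕ} :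
    Before a b (u ++ v) ↔ Before a b u ∨ Before a b v ∨ (a ∈ u ∧ b ∈ v) := by
  induction u with
  | nil => simp [Before]
  | cons c u ih =>
    simp only [List.cons_append, Before, ih, List.mem_append, List.mem_cons]
    grind

theorem Before.mem {a b : ℕ} {u : List ℕ} (h : Before a b u) : a ∈ u ∧ b ∈ u := by
  induction u with
  | nil => simp [Before] at h
  | cons c u ih => grind [Before]

theorem Before.lt {a b : ℕ} {R : List ℕ} (hR : R.Pairwise (· < ·)) (h : Before a b R) : a < b := by
  induction R with
  | nil => simp [Before] at h
  | cons c R ih =>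
    rw [List.pairwise_cons] at hR
    rcases h with ⟨rfl, h⟩ | h
    · exact hR.1 b h
    · exact ih hR.2 h

/-- The words have the same letters, and `k + 1` precedes `k` in both of them or in neither. -/
def SameInverseDescents (u v : List ℕ) : Prop :=
  u.Perm v ∧ ∀ k, Before (k + 1) k u ↔ Before (k + 1) k v

theorem SameInverseDescents.trans {u v w : List ℕ} (h : SameInverseDescents u v)
    (h' : SameInverseDescents v w) : SameInverseDescents u w :=
  ⟨h.1.trans h'.1, fun k => (h.2 k).trans (h'.2 k)⟩

theorem SameInverseDescents.append_left {u v : List ℕ} (h : SameInverseDescents u v)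
    (w : List ℕ) : SameInverseDescents (w ++ u) (w ++ v) :=
  ⟨h.1.append_left w, fun k => by simp only [before_append, h.2, h.1.mem_iff]⟩

theorem SameInverseDescents.append_right {u v : List ℕ} (h : SameInverseDescents u v)
    (w : List ℕ) : SameInverseDescents (u ++ w) (v ++ w) :=
  ⟨h.1.append_right w, fun k => by simp only [before_append, h.2, h.1.mem_iff]⟩

/-- Only `y` with letters of `A`, and `x` with letters of `B`, change their relative order. Such
pairs have `x` or `y` strictly between or as a bound, `a < x < y` and `x < y < b`, so they differ by
at least `2`. -/
theorem sameInverseDescents_bump {A B : List ℕ} {x y : ℕ} (hxy : x < y) (hA : ∀ a ∈ A, a < x)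
    (hB : ∀ b ∈ B, y < b) :
    SameInverseDescents (A ++ y :: B ++ [x]) (y :: (A ++ x :: B)) := by
  constructor
  · refine (List.perm_append_singleton x (A ++ y :: B)).trans ?_
    refine (List.perm_middle.cons x).trans ((List.Perm.swap y x _).trans ?_)
    exact (List.perm_middle.symm).cons y
  · intro k
    simp only [before_append, Before, List.mem_append, List.mem_cons, List.not_mem_nil]
    have h1 := hA k
    have h2 := hA (k + 1)
    have h3 := hB k
    have h4 := hB (k + 1)
    grind

/-- The rows of a filling read from bottom to top. -/
def readingWord (T : Filling) : List ℕ := T.reverse.flatten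

theorem readingWord_cons (R : List ℕ) (T : Filling) :
    readingWord (R :: T) = readingWord T ++ R := by
  simp [readingWord]

theorem mem_readingWord {T : Filling} {a : ℕ} : a ∈ readingWord T ↔ a ∈ T.flatten := by
  simp [readingWord]

/-- A bump turns `R ++ [x]` into `y :: R.set i x`; this places `y` right after the reading word of
the lower rows, where induction takes over. -/
theorem sameInverseDescents_tableauInsert {T : Filling} (hT : IsTableau T) {x : ℕ}
    (hd : (x :: T.flatten).Nodup) :
    SameInverseDescents (readingWord T ++ [x]) (readingWord (tableauInsert x T).1) := by
  induction T generalizing x with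
  | nil => exact ⟨.refl _, fun k => Iff.rfl⟩
  | cons R T ih =>
    obtain ⟨h1, h2, h3, h4⟩ := hT
    rcases rowInsert_spec x R (by grind) with ⟨e1, e2, -⟩ | ⟨i, y, e1, e2, h5, h6, h7⟩
    · have e : rowInsert x R = (R ++ [x], none) := by rw [← e1, ← e2]
      simp only [tableauInsert, e, readingWord_cons, List.append_assoc]
      exact ⟨.refl _, fun k => Iff.rfl⟩
    · have e : rowInsert x R = (R.set i x, some y) := by rw [← e1, ← e2]
      have hy : y ∈ R := List.mem_of_getElem? h5
      obtain ⟨hi, hiy⟩ := List.getElem?_eq_some_iff.1 h5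
      simp only [tableauInsert, e, readingWord_cons]
      have hsplit : R = R.take i ++ y :: R.drop (i + 1) := by
        rw [← hiy, List.cons_getElem_drop_succ, List.take_append_drop]
      have hset : R.set i x = R.take i ++ x :: R.drop (i + 1) := List.set_eq_take_append_cons_drop ..
        |>.trans (by simp [hi])
      have hA : ∀ a ∈ R.take i, a < x := by
        intro a ha
        obtain ⟨j, hj⟩ := List.mem_iff_getElem?.1 ha
        rw [List.getElem?_take] at hj
        split at hj
        · exact h7 j a (by assumption) hj
        · simp at hj
      have hB : ∀ b ∈ R.drop (i + 1), y < b := by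
        intro b hb
        rw [hsplit, List.pairwise_append, List.pairwise_cons] at h2
        exact h2.2.1.1 b hb
      have hstep : SameInverseDescents (R ++ [x]) (y :: R.set i x) := by
        have := sameInverseDescents_bump h6 hA hB
        rwa [← hsplit, ← hset] at this
      have h8 := hstep.append_left (readingWord T)
      rw [← List.append_assoc] at h8
      refine h8.trans ?_
      have h9 := (ih h4 (x := y) (by grind)).append_right (R.set i x)
      rwa [List.append_assoc] at h9

theorem sameInverseDescents_rskRev {w : List ℕ} (hw : w.Nodup) :
    SameInverseDescents w.reverse (readingWord (rskRev w).1) := by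
  induction w with
  | nil => exact ⟨.refl _, fun k => Iff.rfl⟩
  | cons x w ih =>
    have hw' := (List.nodup_cons.1 hw).2
    obtain ⟨h1, h2, -⟩ := rskRev_spec hw'
    rw [List.reverse_cons]
    exact ((ih hw').append_right [x]).trans
      (sameInverseDescents_tableauInsert h1 ((h2.cons x).nodup_iff.2 hw))

/-- Lower rows are read first, and inside an increasing row `k` precedes `k + 1`. -/
theorem rowOf_lt_iff_before {T : Filling} (hT : IsTableau T) (hd : T.flatten.Nodup) {k : ℕ}
    (hk : k ∈ T.flatten) (hk' : k + 1 ∈ T.flatten) :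
    rowOf T k < rowOf T (k + 1) ↔ Before (k + 1) k (readingWord T) := by
  induction T with
  | nil => simp at hk
  | cons R T ih =>
    obtain ⟨h1, h2, h3, h4⟩ := hT
    rw [readingWord_cons, before_append, mem_readingWord]
    have hR : ¬ Before (k + 1) k R := fun h => by have := h.lt h2; omega
    rw [List.flatten_cons, List.nodup_append] at hd
    obtain ⟨hd1, hd2, hd3⟩ := hd
    have hb : Before (k + 1) k (readingWord T) → k + 1 ∈ T.flatten ∧ k ∈ T.flatten := by
      intro h
      have := h.mem
      rwa [mem_readingWord, mem_readingWord] at this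
    rw [List.flatten_cons, List.mem_append] at hk hk'
    have hk3 := fun h : k ∈ R => fun h' : k ∈ T.flatten => hd3 k h k h' rfl
    have hk4 := fun h : k + 1 ∈ R => fun h' : k + 1 ∈ T.flatten => hd3 _ h _ h' rfl
    by_cases ha : k ∈ R <;> by_cases hb' : k + 1 ∈ R
    · simp only [rowOf, List.findIdx_cons, ha, hb']
      simp [-List.mem_flatten]
      tauto
    · simp only [rowOf, List.findIdx_cons, ha, hb']
      simp [-List.mem_flatten]
      tauto
    · simp only [rowOf, List.findIdx_cons, ha, hb']
      simp [-List.mem_flatten]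
      tauto
    · have := ih h4 hd2 (by tauto) (by tauto)
      simp only [rowOf] at this
      simp only [rowOf, List.findIdx_cons, ha, hb']
      simp [this]
      tauto

theorem rowOf_rskRev_fst_lt_iff {w : List ℕ} (hw : w.Nodup) {k : ℕ} (hk : k ∈ w)
    (hk' : k + 1 ∈ w) :
    rowOf (rskRev w).1 k < rowOf (rskRev w).1 (k + 1) ↔ Before (k + 1) k w.reverse := by
  obtain ⟨h1, h2, -⟩ := rskRev_spec hw
  rw [(sameInverseDescents_rskRev hw).2 k]
  exact rowOf_lt_iff_before h1 (h2.nodup_iff.2 hw) (h2.mem_iff.2 hk) (h2.mem_iff.2 hk')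

end Descents

/-! ### Schensted's theorem on longest increasing subsequences -/

section IncreasingSubsequences

/-- Entry `j` of the first row is the least last letter of an increasing subsequence of length `j +
1`; the two parts say that it is attained and that it is minimal. In the backward word such a
subsequence is a decreasing sublist with its last letter at the head. -/
theorem rskRev_headD_spec {w : List ℕ} (hw : w.Nodup) :
    (∀ j x : ℕ, ((rskRev w).1.headD [])[j]? = some x →
      ∃ l : List ℕ, (x :: l).Sublist w ∧ (x :: l).Pairwise (· > ·) ∧ l.length = j) ∧
    ∀ (x : ℕ) (l : List ℕ), (x :: l).Sublist w → (x :: l).Pairwise (· > ·) →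
      ∃ y, ((rskRev w).1.headD [])[l.length]? = some y ∧ y ≤ x := by
  induction w with
  | nil => simp [rskRev]
  | cons z w ih =>
    obtain ⟨hz, hw'⟩ := List.nodup_cons.1 hw
    obtain ⟨ih1, ih2⟩ := ih hw'
    obtain ⟨h1, h2, -⟩ := rskRev_spec hw'
    have hzR : z ∉ (rskRev w).1.headD [] := fun h => hz (h2.mem_iff.1 (headD_subset_flatten h))
    -- Appending and bumping are treated alike: `z` enters column `i`, old entries to the left are
    -- smaller, those from `i` on (if any) are larger, and other columns are unchanged.
    have hpos : ∃ i, ((rskRev (z :: w)).1.headD [])[i]? = some z ∧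
        (∀ j a, j < i → ((rskRev w).1.headD [])[j]? = some a → a < z) ∧
        (∀ j, i < j → ∀ a, ((rskRev w).1.headD [])[j]? = some a → z < a) ∧
        (∀ a, ((rskRev w).1.headD [])[i]? = some a → z < a) ∧
        i ≤ ((rskRev w).1.headD []).length ∧
        ∀ j, j ≠ i → ((rskRev (z :: w)).1.headD [])[j]? = ((rskRev w).1.headD [])[j]? := by
      rw [rskRev, tableauInsert_headD]
      have hR := pairwise_lt_iff_getElem?.1 h1.headD_pairwise
      generalize (rskRev w).1.headD [] = R at *
      rcases rowInsert_spec z R hzR with ⟨-, e2, h5⟩ | ⟨i, y, -, e2, h5, h6, h7⟩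
      · rw [e2]
        refine ⟨R.length, by simp, fun j a _ ha => h5 a (List.mem_of_getElem? ha), ?_, by simp,
          le_rfl, ?_⟩
        · intro j hj a ha
          rw [List.getElem?_eq_none hj.le] at ha
          simp at ha
        · intro j hj
          rcases hj.lt_or_gt with hj | hj
          · rw [List.getElem?_append_left hj]
          · rw [List.getElem?_eq_none hj.le, List.getElem?_eq_none (by simp; omega)]
      · obtain ⟨hi, hy⟩ := List.getElem?_eq_some_iff.1 h5
        rw [e2]
        refine ⟨i, by simp [hi], h7, fun j hj a ha => h6.trans (hR i j y a hj h5 ha), ?_, hi.le,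
          fun j hj => by rw [List.getElem?_set_ne (by omega)]⟩
        intro a ha
        rw [h5, Option.some.injEq] at ha
        omega
    obtain ⟨i, hi, hlt, hgt, hgti, hile, hne⟩ := hpos
    constructor
    · intro j x hx
      by_cases hji : j = i
      · subst hji
        rw [hi, Option.some.injEq] at hx
        subst hx
        cases j with
        | zero => exact ⟨[], by simp, by simp, rfl⟩
        | succ j =>
          have hj : ((rskRev w).1.headD [])[j]? = some ((rskRev w).1.headD [])[j] :=
            List.getElem?_eq_getElem (by omega)
          obtain ⟨l, hl1, hl2, hl3⟩ := ih1 j _ hj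
          have hlz := hlt j _ (by omega) hj
          refine ⟨_ :: l, hl1.cons_cons z, List.pairwise_cons.2 ⟨?_, hl2⟩, by simp [hl3]⟩
          intro b hb
          rcases List.mem_cons.1 hb with rfl | hb
          · exact hlz
          · exact lt_trans ((List.pairwise_cons.1 hl2).1 b hb) hlz
      · rw [hne j hji] at hx
        obtain ⟨l, hl1, hl2, hl3⟩ := ih1 j x hx
        exact ⟨l, hl1.cons z, hl2, hl3⟩
    · intro x l hl hp
      rcases List.sublist_cons_iff.1 hl with hl | ⟨r, hr, hrw⟩
      · obtain ⟨y, hy, hyx⟩ := ih2 x l hl hp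
        by_cases hji : l.length = i
        · rw [hji] at hy ⊢
          exact ⟨z, hi, by have := hgti y hy; omega⟩
        · exact ⟨y, by rw [hne _ hji, hy], hyx⟩
      · rw [List.cons.injEq] at hr
        obtain ⟨rfl, rfl⟩ := hr
        -- The old row has in column `l.length - 1` an entry at most the previous letter, hence
        -- below the new one; but from column `i` on all old entries exceed the new letter.
        have hli : l.length ≤ i := by
          cases l with
          | nil => simp
          | cons a l =>
            obtain ⟨hxa, hp'⟩ := List.pairwise_cons.1 hp
            obtain ⟨y, hy, hya⟩ := ih2 a l hrw hp'
            by_contra! hc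
            have hax := hxa a (by simp)
            rw [List.length_cons] at hc
            rcases (Nat.lt_succ_iff.1 hc).lt_or_eq with hc | hc
            · have := hgt _ hc y hy
              omega
            · have := hgti y (hc ▸ hy)
              omega
        rcases hli.lt_or_eq with hli | hli
        · have hj := List.getElem?_eq_getElem (l := (rskRev w).1.headD []) (i := l.length) (by omega)
          exact ⟨_, by rw [hne _ hli.ne, hj], (hlt _ _ hli hj).le⟩
        · exact ⟨x, hli ▸ hi, le_rfl⟩

theorem numCols_rskRev_le_iff {w : List ℕ} (hw : w.Nodup) (d : ℕ) :
    numCols (rskRev w).1 ≤ d ↔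
      ∀ l : List ℕ, l.Sublist w → l.Pairwise (· > ·) → l.length ≤ d := by
  obtain ⟨h1, h2⟩ := rskRev_headD_spec hw
  rw [numCols]
  constructor
  · intro h l hl hp
    cases l with
    | nil => simp
    | cons x l =>
      obtain ⟨y, hy, -⟩ := h2 x l hl hp
      exact (List.getElem?_eq_some_iff.1 hy).1.trans_le h
  · intro h
    by_contra! hc
    obtain ⟨l, hl1, hl2, hl3⟩ := h1 d _ (List.getElem?_eq_getElem hc)
    have := h _ hl1 hl2
    rw [List.length_cons] at this
    omega

end IncreasingSubsequences

/-! ### From words to permutations -/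

section Permutations

variable {m : ℕ}

/-- The word `π(1), ..., π(m)` of a permutation of `[m]`. -/
def permWord (π : Equiv.Perm (Fin m)) : List ℕ := (List.finRange m).map fun i => (π i : ℕ) + 1

theorem permWord_nodup (π : Equiv.Perm (Fin m)) : (permWord π).Nodup := by
  refine (List.nodup_finRange m).map fun i j h => π.injective (Fin.ext ?_)
  simpa using h

theorem getElem?_permWord {π : Equiv.Perm (Fin m)} {i a : ℕ} :
    (permWord π)[i]? = some a ↔ ∃ h : i < m, (π ⟨i, h⟩ : ℕ) + 1 = a := by
  rw [List.getElem?_eq_some_iff]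
  simp [permWord]

theorem mem_permWord {π : Equiv.Perm (Fin m)} (k : Fin m) : (k : ℕ) + 1 ∈ permWord π :=
  List.mem_map.2 ⟨π.symm k, by simp, by simp⟩

theorem permWord_perm (π : Equiv.Perm (Fin m)) : (permWord π).Perm (List.range' 1 m) := by
  refine (List.perm_ext_iff_of_nodup (permWord_nodup π) List.nodup_range').2 fun a => ?_
  rw [List.mem_range'_1]
  constructor
  · intro h
    obtain ⟨i, -, rfl⟩ := List.mem_map.1 h
    have := (π i).isLt
    omega
  · rintro ⟨h1, h2⟩
    have := mem_permWord (π := π) ⟨a - 1, by omega⟩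
    rwa [show a - 1 + 1 = a by omega] at this

theorem rsk_eq (π : Equiv.Perm (Fin m)) : rsk π = rskRev (permWord π).reverse := rsk_eq_rskRev π

theorem permWord_reverse_nodup (π : Equiv.Perm (Fin m)) : (permWord π).reverse.Nodup :=
  List.nodup_reverse.2 (permWord_nodup π)

theorem rsk_spec (π : Equiv.Perm (Fin m)) :
    IsStandardTableau m (rsk π).1 ∧ IsStandardTableau m (rsk π).2 ∧
      shape (rsk π).1 = shape (rsk π).2 := by
  obtain ⟨h1, h2, h3, h4, h5⟩ := rskRev_spec (permWord_reverse_nodup π)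
  rw [isStandardTableau_iff, isStandardTableau_iff, rsk_eq]
  refine ⟨⟨h1, ?_⟩, ⟨h3, ?_⟩, h5⟩
  · exact (h2.trans (List.reverse_perm _)).trans (permWord_perm π)
  · simpa [permWord] using h4

theorem rsk_injective : Function.Injective (rsk (m := m)) := by
  intro π σ h
  rw [rsk_eq, rsk_eq] at h
  have h' := List.reverse_injective
    (rskRev_injective (permWord_reverse_nodup π) (permWord_reverse_nodup σ) h)
  ext i
  have h1 : (permWord π)[(i : ℕ)]? = some ((π i : ℕ) + 1) := getElem?_permWord.2 ⟨i.2, rfl⟩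
  rw [h'] at h1
  obtain ⟨_, h2⟩ := getElem?_permWord.1 h1
  simp only [Fin.eta] at h2
  omega

theorem exists_permWord_eq {w : List ℕ} (hw : w.Perm (List.range' 1 m)) :
    ∃ π : Equiv.Perm (Fin m), permWord π = w := by
  have hlen : w.length = m := by simpa using hw.length_eq
  have hmem : ∀ i : Fin m, 1 ≤ w[(i : ℕ)] ∧ w[(i : ℕ)] < 1 + m := fun i =>
    List.mem_range'_1.1 (hw.mem_iff.1 (List.getElem_mem _))
  let f : Fin m → Fin m := fun i => ⟨w[(i : ℕ)] - 1, by have := hmem i; omega⟩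
  have hf : Function.Injective f := by
    intro i j hij
    have h1 := hmem i
    have h2 := hmem j
    have h3 : w[(i : ℕ)] - 1 = w[(j : ℕ)] - 1 := congrArg Fin.val hij
    exact Fin.ext ((hw.nodup_iff.2 List.nodup_range').getElem_inj_iff.1 (by omega))
  refine ⟨Equiv.ofBijective f (Finite.injective_iff_bijective.1 hf), ?_⟩
  refine List.ext_getElem (by simp [permWord, hlen]) fun i h1 h2 => ?_
  have := hmem ⟨i, hlen ▸ h2⟩
  simp only at this
  simp [permWord, f]
  omega

theorem exists_rsk_eq {P Q : Filling} (hP : IsStandardTableau m P) (hQ : IsStandardTableau m Q)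
    (hs : shape P = shape Q) : ∃ π : Equiv.Perm (Fin m), rsk π = (P, Q) := by
  rw [isStandardTableau_iff] at hP hQ
  obtain ⟨w, hw, h⟩ := exists_rskRev_eq hP.1 (hP.2.nodup_iff.2 List.nodup_range') hQ.1 hQ.2 hs
  have h2 := (rskRev_spec hw).2.1
  rw [h] at h2
  obtain ⟨π, hπ⟩ := exists_permWord_eq (((List.reverse_perm w).trans h2.symm).trans hP.2)
  exact ⟨π, by rw [rsk_eq, hπ, List.reverse_reverse, h]⟩

theorem rowOf_rsk_snd_lt_iff (π : Equiv.Perm (Fin m)) (i : ℕ) (h : i + 1 < m) :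
    rowOf (rsk π).2 (i + 1) < rowOf (rsk π).2 (i + 2) ↔ π ⟨i + 1, h⟩ < π ⟨i, by omega⟩ := by
  have hlen : (permWord π).length = m := by simp [permWord]
  have hsplit : (permWord π).reverse = ((permWord π).drop (i + 2)).reverse ++
      ((π ⟨i + 1, h⟩ : ℕ) + 1) :: ((π ⟨i, by omega⟩ : ℕ) + 1) :: ((permWord π).take i).reverse := by
    have h1 : (permWord π)[i]'(by omega) = (π ⟨i, by omega⟩ : ℕ) + 1 := by simp [permWord]
    have h2 : (permWord π)[i + 1]'(by omega) = (π ⟨i + 1, h⟩ : ℕ) + 1 := by simp [permWord]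
    conv_lhs => rw [← List.take_append_drop i (permWord π)]
    rw [List.drop_eq_getElem_cons (by omega), List.drop_eq_getElem_cons (by omega), h1, h2]
    simp
  have hnd := permWord_reverse_nodup π
  have hC : ((permWord π).take i).reverse.length = i := by simp [hlen]; omega
  rw [hsplit] at hnd
  have := rowOf_rskRev_snd_lt_iff hnd
  rw [← hsplit, hC] at this
  rw [rsk_eq, this, Fin.lt_def]
  omega

theorem before_iff_getElem? {a b : ℕ} {w : List ℕ} :
    Before a b w ↔ ∃ i j : ℕ, i < j ∧ w[i]? = some a ∧ w[j]? = some b := by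
  induction w with
  | nil => simp [Before]
  | cons c w ih =>
    rw [Before, ih]
    constructor
    · rintro (⟨rfl, h⟩ | ⟨i, j, hij, hi, hj⟩)
      · obtain ⟨j, hj⟩ := List.mem_iff_getElem?.1 h
        exact ⟨0, j + 1, by omega, by simp, by simpa using hj⟩
      · exact ⟨i + 1, j + 1, by omega, by simpa using hi, by simpa using hj⟩
    · rintro ⟨i, j, hij, hi, hj⟩
      obtain ⟨j, rfl⟩ : ∃ j', j = j' + 1 := ⟨j - 1, by omega⟩
      rw [List.getElem?_cons_succ] at hj
      cases i with
      | zero => exact Or.inl ⟨by simpa using hi, List.mem_of_getElem? hj⟩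
      | succ i => exact Or.inr ⟨i, j, by omega, by simpa using hi, hj⟩

theorem rowOf_rsk_fst_lt_iff (π : Equiv.Perm (Fin m)) (k : ℕ) (h : k + 1 < m) :
    rowOf (rsk π).1 (k + 1) < rowOf (rsk π).1 (k + 2) ↔
      π.symm ⟨k + 1, h⟩ < π.symm ⟨k, by omega⟩ := by
  rw [rsk_eq, rowOf_rskRev_fst_lt_iff (permWord_reverse_nodup π)
    (List.mem_reverse.2 (mem_permWord ⟨k, by omega⟩))
    (List.mem_reverse.2 (mem_permWord ⟨k + 1, h⟩)), List.reverse_reverse, before_iff_getElem?]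
  simp only [getElem?_permWord]
  constructor
  · rintro ⟨i, j, hij, ⟨hi, hi'⟩, ⟨hj, hj'⟩⟩
    have e1 : π.symm ⟨k + 1, h⟩ = ⟨i, hi⟩ := by
      rw [Equiv.symm_apply_eq]; ext; simp; omega
    have e2 : π.symm ⟨k, by omega⟩ = ⟨j, hj⟩ := by
      rw [Equiv.symm_apply_eq]; ext; simp; omega
    rw [e1, e2]
    exact hij
  · intro hlt
    exact ⟨_, _, hlt, ⟨Fin.isLt _, by simp⟩, ⟨Fin.isLt _, by simp⟩⟩

theorem numCols_rsk_le_iff (π : Equiv.Perm (Fin m)) (d : ℕ) :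
    numCols (rsk π).1 ≤ d ↔ ∀ S : Finset (Fin m), StrictMonoOn π S → S.card ≤ d := by
  rw [rsk_eq, numCols_rskRev_le_iff (permWord_reverse_nodup π)]
  constructor
  · intro h S hS
    have h1 : (((List.finRange m).filter (· ∈ S)).map fun i => (π i : ℕ) + 1).Sublist
        (permWord π) := List.filter_sublist.map _
    have h2 := h _ h1.reverse ?_
    · have h3 : ((List.finRange m).filter (· ∈ S)).toFinset = S := by ext; simp
      rw [List.length_reverse, List.length_map] at h2
      rw [← h3]
      exact (List.toFinset_card_le _).trans h2
    · rw [List.pairwise_reverse, List.pairwise_map]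
      have h4 : ((List.finRange m).filter (· ∈ S)).Pairwise (· < ·) :=
        (List.pairwise_lt_finRange m).filter _
      refine h4.imp_of_mem fun {a b} ha hb hab => ?_
      have := hS (by simpa using ha) (by simpa using hb) hab
      simpa using this
  · intro h l hl hp
    rw [permWord, ← List.map_reverse] at hl
    obtain ⟨l', hl', rfl⟩ := List.sublist_map_iff.1 hl
    have h1 : l'.Pairwise (· > ·) := by
      refine List.Pairwise.sublist hl' ?_
      rw [List.pairwise_reverse]
      exact List.pairwise_lt_finRange m
    rw [List.pairwise_map] at hp
    have h2 := h l'.toFinset ?_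
    · rwa [List.toFinset_card_of_nodup (h1.imp fun h => ne_of_gt h), ← List.length_map] at h2
    · have h3 : ∀ a ∈ l', ∀ b ∈ l', a < b → π a < π b := by
        have h4 := h1.and hp
        clear h1 hp hl' hl h
        induction l' with
        | nil => simp
        | cons c l' ih =>
          obtain ⟨h5, h6⟩ := List.pairwise_cons.1 h4
          intro a ha b hb hab
          rcases List.mem_cons.1 ha with rfl | ha' <;> rcases List.mem_cons.1 hb with rfl | hb'
          · exact absurd hab (lt_irrefl _)
          · exact absurd hab (h5 b hb').1.not_gt
          · have := (h5 a ha').2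
            rw [Fin.lt_def]
            omega
          · exact ih h6 a ha' b hb' hab
      intro a ha b hb hab
      exact h3 a (by simpa using ha) b (by simpa using hb) hab

/-- Serves both tableaux: `g` is `π` for `Q` and its inverse for `P`. Strict decrease on a block
need only be tested on neighbours, which is what Condition (T) does. -/
theorem conditionT_iff_strictAnti {n r : ℕ} {T : Filling} (g : Fin (n * r) → Fin (n * r))
    (hg : ∀ i (h : i + 1 < n * r),
      rowOf T (i + 1) < rowOf T (i + 2) ↔ g ⟨i + 1, h⟩ < g ⟨i, by omega⟩) :
    ConditionT n r T ↔ ∀ i : Fin n, StrictAnti fun s : Fin r => g (finProdFinEquiv (i, s)) := by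
  cases r with
  | zero =>
    constructor
    · intro _ i s
      exact s.elim0
    · intro _ i s _ _ _ h
      omega
  | succ r =>
    have hval : ∀ (i : Fin n) (s : Fin (r + 1)),
        (finProdFinEquiv (i, s) : ℕ) = (r + 1) * i + s := fun i s => by
      simp [finProdFinEquiv, Nat.add_comm]
    simp only [Fin.strictAnti_iff_succ_lt]
    constructor
    · intro h i s
      have hlt := (finProdFinEquiv (i, s.succ)).isLt
      rw [hval, Fin.val_succ] at hlt
      have h1 := h (i + 1) (s + 1) (by omega) (by omega) (by omega) (by omega)
      rw [Nat.add_sub_cancel] at h1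
      have h2 := (hg ((r + 1) * i + s) (by omega)).1 h1
      rwa [show finProdFinEquiv (i, s.succ) = ⟨(r + 1) * i + s + 1, by omega⟩ from
          Fin.ext (by rw [hval, Fin.val_succ]; rfl),
        show finProdFinEquiv (i, s.castSucc) = ⟨(r + 1) * i + s, by omega⟩ from
          Fin.ext (by rw [hval, Fin.val_castSucc])]
    · intro h i s hi hi' hs hs'
      have h1 := h ⟨i - 1, by omega⟩ ⟨s - 1, by omega⟩
      have hlt := (finProdFinEquiv ((⟨i - 1, by omega⟩ : Fin n),
        (⟨s - 1, by omega⟩ : Fin r).succ)).isLt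
      rw [hval, Fin.val_succ] at hlt
      simp only at hlt
      have h2 := (hg ((r + 1) * (i - 1) + (s - 1)) (by omega)).2 ?_
      · rwa [show (r + 1) * (i - 1) + (s - 1) + 1 = (r + 1) * (i - 1) + s by omega,
          show (r + 1) * (i - 1) + (s - 1) + 2 = (r + 1) * (i - 1) + s + 1 by omega] at h2
      · rwa [show finProdFinEquiv (_, Fin.succ _) = ⟨(r + 1) * (i - 1) + (s - 1) + 1, by omega⟩ from
            Fin.ext (by rw [hval, Fin.val_succ]; rfl),
          show finProdFinEquiv (_, Fin.castSucc _) = ⟨(r + 1) * (i - 1) + (s - 1), by omega⟩ from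
            Fin.ext (by rw [hval, Fin.val_castSucc])] at h1

end Permutations

/-! ### Configurations of multigraphs as block-decreasing configurations -/

section Configurations

variable {U V : Type*} [LinearOrder U] [Fintype U] [LinearOrder V] [Fintype V] {r : ℕ}

theorem lexRank_lt_iff {n : ℕ} (hU : Fintype.card U = n) (p q : U × Fin r) :
    lexRank hU p < lexRank hU q ↔ p.1 < q.1 ∨ p.1 = q.1 ∧ p.2 < q.2 := by
  have hval : ∀ p : U × Fin r, (lexRank hU p : ℕ) =
      p.2 + r * ((Fintype.orderIsoFinOfCardEq U hU).symm p.1 : ℕ) := fun p => rfl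
  have h : ∀ p q : U × Fin r, p.1 < q.1 → lexRank hU p < lexRank hU q := by
    intro p q hpq
    rw [Fin.lt_def, hval, hval]
    have h1 : (Fintype.orderIsoFinOfCardEq U hU).symm p.1 <
      (Fintype.orderIsoFinOfCardEq U hU).symm q.1 := (OrderIso.lt_iff_lt _).2 hpq
    have h2 := Nat.mul_le_mul_left r (Nat.succ_le_of_lt (Fin.lt_def.1 h1))
    have := p.2.isLt
    rw [Nat.mul_succ] at h2
    omega
  rcases lt_trichotomy p.1 q.1 with h1 | h1 | h1
  · simp [h1, h p q h1]
  · simp only [h1, lt_irrefl, true_and, false_or]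
    rw [Fin.lt_def, hval, hval, h1, Fin.lt_def]
    omega
  · simp [h1.not_gt, h1.ne', (h q p h1).le]

/-- Within each block `u^1, ..., u^r` the configuration is lexicographically decreasing. -/
def Configuration.IsBlockDecreasing (F : Configuration U V r) : Prop :=
  ∀ u, StrictAnti fun s => toLex (F (u, s))

theorem toLex_lt_iff_lexRank {n : ℕ} (hU : Fintype.card U = n) (p q : U × Fin r) :
    toLex p < toLex q ↔ lexRank hU p < lexRank hU q := by
  rw [lexRank_lt_iff, Prod.Lex.toLex_lt_toLex]

theorem isBlockDecreasing_iff {n : ℕ} (hU : Fintype.card U = n) (hV : Fintype.card V = n)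
    (F : Configuration U V r) :
    F.IsBlockDecreasing ↔
      ∀ i : Fin n, StrictAnti fun s : Fin r => F.toPerm hU hV (finProdFinEquiv (i, s)) := by
  rw [Configuration.IsBlockDecreasing, ← (Fintype.orderIsoFinOfCardEq U hU).forall_congr_right]
  refine forall_congr' fun i => ?_
  simp only [StrictAnti, toLex_lt_iff_lexRank hV]
  simp [Configuration.toPerm, lexRank]

theorem conditionT_rsk_snd_iff {n : ℕ} (hU : Fintype.card U = n) (hV : Fintype.card V = n)
    (F : Configuration U V r) :
    ConditionT n r (rsk (F.toPerm hU hV)).2 ↔ F.IsBlockDecreasing := by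
  rw [isBlockDecreasing_iff hU hV]
  exact conditionT_iff_strictAnti _ (rowOf_rsk_snd_lt_iff _)

theorem conditionT_rsk_fst_iff {n : ℕ} (hU : Fintype.card U = n) (hV : Fintype.card V = n)
    (F : Configuration U V r) :
    ConditionT n r (rsk (F.toPerm hU hV)).1 ↔
      Configuration.IsBlockDecreasing (U := V) (V := U) F.symm := by
  rw [isBlockDecreasing_iff hV hU]
  exact conditionT_iff_strictAnti _ (rowOf_rsk_fst_lt_iff _)

namespace RegularMultigraph

theorem toConfiguration_leftEnd (G : RegularMultigraph U V r) (e : G.Edge) :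
    G.toConfiguration (G.leftEnd e) = G.rightEnd e := by
  simp only [toConfiguration, Equiv.trans_apply]
  rw [Equiv.ofBijective_symm_apply_apply, Equiv.ofBijective_apply]

theorem toConfiguration_symm_rightEnd (G : RegularMultigraph U V r) (e : G.Edge) :
    G.toConfiguration.symm (G.rightEnd e) = G.leftEnd e := by
  rw [Equiv.symm_apply_eq, toConfiguration_leftEnd]

/-- `leftOffset` counts the edges to larger `v`, so a larger upper index at `u` means a smaller or
equal `v`; among parallel edges the order is reversed by `rightEnd`. -/
theorem isBlockDecreasing_toConfiguration (G : RegularMultigraph U V r) :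
    G.toConfiguration.IsBlockDecreasing := by
  intro u s s' hs
  obtain ⟨⟨u1, v, k⟩, he⟩ := G.leftEnd_bijective.2 (u, s)
  obtain ⟨⟨u2, v', k'⟩, he'⟩ := G.leftEnd_bijective.2 (u, s')
  simp only
  rw [← he, ← he', toConfiguration_leftEnd, toConfiguration_leftEnd, Prod.Lex.toLex_lt_toLex]
  simp only [leftEnd, Prod.mk.injEq] at he he'
  obtain ⟨rfl, rfl⟩ := he
  obtain ⟨rfl, rfl⟩ := he'
  rw [Fin.lt_def] at hs
  simp only at hs
  rcases lt_trichotomy v v' with hv | rfl | hv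
  · have := G.leftOffset_add_mult_le_of_lt u2 hv
    omega
  · right
    simp only [rightEnd, Fin.lt_def, Fin.val_rev, true_and]
    omega
  · exact Or.inl hv

theorem isBlockDecreasing_toConfiguration_symm (G : RegularMultigraph U V r) :
    Configuration.IsBlockDecreasing (U := V) (V := U) G.toConfiguration.symm := by
  intro v s s' hs
  obtain ⟨⟨u, v1, k⟩, he⟩ := G.rightEnd_bijective.2 (v, s)
  obtain ⟨⟨u', v2, k'⟩, he'⟩ := G.rightEnd_bijective.2 (v, s')
  simp only
  rw [← he, ← he', toConfiguration_symm_rightEnd, toConfiguration_symm_rightEnd,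
    Prod.Lex.toLex_lt_toLex]
  simp only [rightEnd, Prod.mk.injEq] at he he'
  obtain ⟨rfl, rfl⟩ := he
  obtain ⟨rfl, rfl⟩ := he'
  rw [Fin.lt_def] at hs
  simp only [Fin.val_rev] at hs
  rcases lt_trichotomy u u' with hu | rfl | hu
  · have := G.rightOffset_add_mult_le_of_lt v2 hu
    omega
  · right
    simp only [leftEnd, Fin.lt_def, true_and]
    omega
  · exact Or.inl hu

theorem mult_eq_card (G : RegularMultigraph U V r) (u : U) (v : V) :
    G.mult u v = (Finset.univ.filter fun s => (G.toConfiguration (u, s)).1 = v).card := by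
  rw [← Fintype.card_fin (G.mult u v), ← Finset.card_univ]
  refine Finset.card_bij (fun k _ => (G.leftEnd ⟨u, v, k⟩).2) ?_ ?_ ?_
  · intro k _
    have := G.toConfiguration_leftEnd ⟨u, v, k⟩
    simp only [Finset.mem_filter, Finset.mem_univ, true_and]
    exact congrArg Prod.fst this
  · intro k _ k' _ h
    have : G.leftEnd ⟨u, v, k⟩ = G.leftEnd ⟨u, v, k'⟩ := Prod.ext rfl h
    simpa using G.leftEnd_bijective.1 this
  · intro s hs
    obtain ⟨⟨u1, v1, k⟩, he⟩ := G.leftEnd_bijective.2 (u, s)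
    obtain rfl : u1 = u := congrArg Prod.fst he
    simp only [Finset.mem_filter, Finset.mem_univ, true_and] at hs
    rw [← he, toConfiguration_leftEnd] at hs
    obtain rfl : v1 = v := hs
    exact ⟨k, Finset.mem_univ _, congrArg Prod.snd he⟩

theorem toConfiguration_injective :
    Function.Injective (toConfiguration (U := U) (V := V) (r := r)) := by
  intro G G' h
  ext u v
  rw [mult_eq_card, mult_eq_card, h]

end RegularMultigraph

namespace Configuration

theorem card_filter_symm (F : Configuration U V r) (u : U) (v : V)
    (p : Fin r → Fin r → Prop) [∀ s j, Decidable (p s j)] :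
    (Finset.univ.filter fun s => (F (u, s)).1 = v ∧ p s (F (u, s)).2).card =
      (Finset.univ.filter fun j => (F.symm (v, j)).1 = u ∧ p (F.symm (v, j)).2 j).card := by
  refine Finset.card_nbij' (fun s => (F (u, s)).2) (fun j => (F.symm (v, j)).2) ?_ ?_ ?_ ?_
  · intro s hs
    simp only [Finset.coe_filter, Finset.mem_univ, true_and, Set.mem_ofPred_eq] at hs ⊢
    have : (v, (F (u, s)).2) = F (u, s) := Prod.ext hs.1.symm rfl
    rw [this, Equiv.symm_apply_apply]
    exact ⟨rfl, hs.2⟩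
  · intro j hj
    simp only [Finset.coe_filter, Finset.mem_univ, true_and, Set.mem_ofPred_eq] at hj ⊢
    have : (u, (F.symm (v, j)).2) = F.symm (v, j) := Prod.ext hj.1.symm rfl
    rw [this, Equiv.apply_symm_apply]
    exact ⟨rfl, hj.2⟩
  · intro s hs
    simp only [Finset.coe_filter, Finset.mem_univ, true_and, Set.mem_ofPred_eq] at hs
    have : (v, (F (u, s)).2) = F (u, s) := Prod.ext hs.1.symm rfl
    simp only [this, Equiv.symm_apply_apply]
  · intro j hj
    simp only [Finset.coe_filter, Finset.mem_univ, true_and, Set.mem_ofPred_eq] at hj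
    have : (u, (F.symm (v, j)).2) = F.symm (v, j) := Prod.ext hj.1.symm rfl
    simp only [this, Equiv.apply_symm_apply]

theorem card_fiber_symm (F : Configuration U V r) (u : U) (v : V) :
    (Finset.univ.filter fun s => (F (u, s)).1 = v).card =
      (Finset.univ.filter fun j => (F.symm (v, j)).1 = u).card := by
  simpa using F.card_filter_symm u v fun _ _ => True

theorem sum_card_fiber (F : Configuration U V r) (u : U) :
    ∑ v, (Finset.univ.filter fun s => (F (u, s)).1 = v).card = r := by
  rw [← Finset.card_eq_sum_card_fiberwise (s := Finset.univ) (t := Finset.univ)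
    (f := fun s => (F (u, s)).1) (by simp), Finset.card_univ, Fintype.card_fin]

theorem sum_card_fiber_gt (F : Configuration U V r) (u : U) (v : V) :
    ∑ v' ∈ Finset.univ.filter (fun v' => v < v'),
      (Finset.univ.filter fun s => (F (u, s)).1 = v').card =
      (Finset.univ.filter fun s => v < (F (u, s)).1).card := by
  rw [Finset.card_eq_sum_card_fiberwise (s := Finset.univ.filter fun s => v < (F (u, s)).1)
    (t := Finset.univ.filter (fun v' => v < v')) (f := fun s => (F (u, s)).1)
    (fun s hs => by simpa using hs)]
  refine Finset.sum_congr rfl fun v' hv' => ?_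
  congr 1
  ext s
  simp only [Finset.mem_filter, Finset.mem_univ, true_and] at hv' ⊢
  constructor
  · rintro rfl
    exact ⟨hv', rfl⟩
  · exact fun h => h.2

/-- The multigraph obtained from a configuration by forgetting the second coordinates. -/
def toMultigraph (F : Configuration U V r) : RegularMultigraph U V r where
  mult u v := (Finset.univ.filter fun s => (F (u, s)).1 = v).card
  degree_left u := F.sum_card_fiber u
  degree_right v := (Finset.sum_congr rfl fun u _ => F.card_fiber_symm u v).trans
    (sum_card_fiber (U := V) (V := U) F.symm v)

theorem leftOffset_toMultigraph (F : Configuration U V r) (u : U) (v : V) :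
    F.toMultigraph.leftOffset u v = (Finset.univ.filter fun s => v < (F (u, s)).1).card :=
  F.sum_card_fiber_gt u v

theorem rightOffset_toMultigraph (F : Configuration U V r) (u : U) (v : V) :
    F.toMultigraph.rightOffset u v =
      (Finset.univ.filter fun j => u < (F.symm (v, j)).1).card :=
  (Finset.sum_congr rfl fun u' _ => F.card_fiber_symm u' v).trans
    (sum_card_fiber_gt (U := V) (V := U) F.symm v u)

/-- The value `s` counts the indices below it. By block decrease these are the indices sent to a
larger vertex, together with the smaller ones sent to the same vertex: an offset plus a position
among parallel edges. -/
theorem IsBlockDecreasing.snd_eq {F : Configuration U V r} (hF : F.IsBlockDecreasing) (u : U)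
    (s : Fin r) :
    (s : ℕ) = (Finset.univ.filter fun s' => (F (u, s)).1 < (F (u, s')).1).card +
      (Finset.univ.filter fun s' => (F (u, s')).1 = (F (u, s)).1 ∧ s' < s).card := by
  have h1 : ((Finset.univ : Finset (Fin r)).filter fun s' => s' < s).card = s := by
    rw [Finset.filter_gt_eq_Iio, Fin.card_Iio]
  rw [← Finset.card_union_of_disjoint]
  · conv_lhs => rw [← h1]
    congr 1
    ext s'
    have h2 : s' < s ↔ _ := ((hF u).lt_iff_gt (a := s) (b := s')).symm
    simp only [Prod.Lex.toLex_lt_toLex] at h2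
    simp only [Finset.mem_union, Finset.mem_filter, Finset.mem_univ, true_and]
    constructor
    · intro h
      rcases h2.1 h with h3 | h3
      · exact Or.inl h3
      · exact Or.inr ⟨h3.1.symm, h⟩
    · rintro (h | h)
      · exact h2.2 (Or.inl h)
      · exact h.2
  · rw [Finset.disjoint_filter]
    intro s' _ h h'
    exact h.ne' h'.1

theorem IsBlockDecreasing.lt_iff {F : Configuration U V r} (hF : F.IsBlockDecreasing) {u : U}
    {s s' : Fin r} (h : (F (u, s')).1 = (F (u, s)).1) :
    (F (u, s')).2 < (F (u, s)).2 ↔ s < s' := by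
  rw [← (hF u).lt_iff_gt (a := s') (b := s), Prod.Lex.toLex_lt_toLex]
  exact ⟨fun h' => Or.inr ⟨h, h'⟩, fun h' => h'.elim (fun h' => absurd h h'.ne) And.right⟩

/-- Counting at `u` and at `v` expresses `s` and `j` as an offset plus a rank among the pairs
joining `u` and `v`. Since `F` reverses the order of these pairs, the two ranks add up to the
multiplicity minus one, as `Fin.rev` prescribes. -/
theorem toConfiguration_toMultigraph {F : Configuration U V r} (hF : F.IsBlockDecreasing)
    (hF' : IsBlockDecreasing (U := V) (V := U) F.symm) :
    F.toMultigraph.toConfiguration = F := by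
  ext1 ⟨u, s⟩
  obtain ⟨v, j, hvj⟩ : ∃ v j, F (u, s) = (v, j) := ⟨_, _, rfl⟩
  have hus : F.symm (v, j) = (u, s) := by rw [← hvj, Equiv.symm_apply_apply]
  have h1 := hF.snd_eq u s
  have h2 := IsBlockDecreasing.snd_eq (U := V) (V := U) hF' v j
  rw [hvj, ← leftOffset_toMultigraph] at h1
  rw [hus, ← rightOffset_toMultigraph] at h2
  simp only at h1 h2
  have h3 : (Finset.univ.filter fun j' => (F.symm (v, j')).1 = u ∧ j' < j).card =
      (Finset.univ.filter fun s' => (F (u, s')).1 = v ∧ s < s').card := by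
    rw [← F.card_filter_symm u v fun _ j' => j' < j]
    congr 1
    ext s'
    simp only [Finset.mem_filter, Finset.mem_univ, true_and]
    refine and_congr_right fun h => ?_
    have := hF.lt_iff (u := u) (s := s) (s' := s') (by rw [h, hvj])
    rwa [hvj] at this
  have h4 : (Finset.univ.filter fun s' => (F (u, s')).1 = v ∧ s' < s).card +
      (Finset.univ.filter fun s' => (F (u, s')).1 = v ∧ s < s').card + 1 =
      F.toMultigraph.mult u v := by
    rw [← Finset.card_union_of_disjoint, ← Finset.card_insert_of_notMem (a := s)]
    · refine congrArg Finset.card (?_ : _ = Finset.univ.filter fun s => (F (u, s)).1 = v)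
      ext s'
      simp only [Finset.mem_insert, Finset.mem_union, Finset.mem_filter, Finset.mem_univ, true_and]
      constructor
      · rintro (rfl | h | h)
        · rw [hvj]
        · exact h.1
        · exact h.1
      · intro h
        rcases lt_trichotomy s' s with h' | h' | h'
        · exact Or.inr (Or.inl ⟨h, h'⟩)
        · exact Or.inl h'
        · exact Or.inr (Or.inr ⟨h, h'⟩)
    · simp
    · rw [Finset.disjoint_filter]
      intro s' _ h h'
      exact h.2.not_gt h'.2
  -- The rank `k` singles out the parallel edge whose endpoints are `(u, s)` and `(v, j)`.
  set k := (Finset.univ.filter fun s' => (F (u, s')).1 = v ∧ s' < s).card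
  let e : F.toMultigraph.Edge := ⟨u, v, ⟨k, by omega⟩⟩
  have he : F.toMultigraph.leftEnd e = (u, s) := Prod.ext rfl (Fin.ext h1.symm)
  have he' : F.toMultigraph.rightEnd e = (v, j) := by
    refine Prod.ext rfl (Fin.ext ?_)
    simp only [RegularMultigraph.rightEnd, e, Fin.val_rev]
    omega
  rw [← he, RegularMultigraph.toConfiguration_leftEnd, he', he, hvj]

end Configuration

/-! ### Planar matchings as increasing subsequences -/

namespace RegularMultigraph

/-- Edges sharing an endpoint are ordered oppositely on the two sides, by block decrease, so an
increase of both ranks forces distinct endpoints. -/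
theorem noncrossing_iff {n : ℕ} (hU : Fintype.card U = n) (hV : Fintype.card V = n)
    (G : RegularMultigraph U V r) (e e' : G.Edge) :
    (e.1 < e'.1 ∧ e.2.1 < e'.2.1) ↔ (lexRank hU (G.leftEnd e) < lexRank hU (G.leftEnd e') ∧
      lexRank hV (G.rightEnd e) < lexRank hV (G.rightEnd e')) := by
  have hl : ∀ e, (G.leftEnd e).1 = e.1 := fun e => rfl
  have hr : ∀ e, (G.rightEnd e).1 = e.2.1 := fun e => rfl
  constructor
  · rintro ⟨h1, h2⟩
    rw [lexRank_lt_iff, lexRank_lt_iff]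
    exact ⟨Or.inl h1, Or.inl h2⟩
  · rintro ⟨h1, h2⟩
    have h3 := (lexRank_lt_iff hU _ _).1 h1
    have h4 := (lexRank_lt_iff hV _ _).1 h2
    constructor
    · refine h3.resolve_right fun h => ?_
      have := G.isBlockDecreasing_toConfiguration (G.leftEnd e).1 h.2
      simp only at this
      rw [toLex_lt_iff_lexRank hV, h.1, Prod.mk.eta, toConfiguration_leftEnd, ← h.1, Prod.mk.eta,
        toConfiguration_leftEnd] at this
      exact this.not_gt h2
    · refine h4.resolve_right fun h => ?_
      have := G.isBlockDecreasing_toConfiguration_symm (G.rightEnd e).1 h.2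
      simp only at this
      rw [toLex_lt_iff_lexRank hU, h.1, Prod.mk.eta, toConfiguration_symm_rightEnd, ← h.1,
        Prod.mk.eta, toConfiguration_symm_rightEnd] at this
      exact this.not_gt h1

theorem maxPlanarMatching_le_iff {n : ℕ} (hU : Fintype.card U = n) (hV : Fintype.card V = n)
    (G : RegularMultigraph U V r) (d : ℕ) :
    G.maxPlanarMatching ≤ d ↔ ∀ S : Finset (Fin (n * r)),
      StrictMonoOn (G.toConfiguration.toPerm hU hV) S → S.card ≤ d := by
  classical
  -- Edges are numbered by the ranks of their left ends; the permutation then sends the number of an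
  -- edge to the rank of its right end.
  let E : G.Edge ≃ Fin (n * r) := (Equiv.ofBijective _ G.leftEnd_bijective).trans (lexRank hU)
  have hE : ∀ e, E e = lexRank hU (G.leftEnd e) := fun e => rfl
  have hπ : ∀ e, G.toConfiguration.toPerm hU hV (E e) = lexRank hV (G.rightEnd e) := fun e => by
    simp [Configuration.toPerm, hE, toConfiguration_leftEnd]
  have key : ∀ M : Finset G.Edge, G.IsPlanarMatching M ↔
      StrictMonoOn (G.toConfiguration.toPerm hU hV) (M.map E.toEmbedding : Finset _) := by
    intro M
    have hmem : ∀ e, E e ∈ ((M.map E.toEmbedding : Finset _) : Set (Fin (n * r))) ↔ e ∈ M := by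
      intro e
      simp
    constructor
    · intro h a ha b hb hab
      obtain ⟨e, rfl⟩ := E.surjective a
      obtain ⟨e', rfl⟩ := E.surjective b
      rw [hmem] at ha hb
      rw [hπ, hπ]
      rcases h e ha e' hb (fun h => hab.ne (by rw [h])) with h | h
      · exact ((noncrossing_iff hU hV G e e').1 h).2
      · exact absurd ((noncrossing_iff hU hV G e' e).1 h).1 hab.not_gt
    · intro h e he e' he' hne
      rcases lt_or_gt_of_ne (fun h => hne (E.injective h) : E e ≠ E e') with hlt | hlt
      · have := h ((hmem e).2 he) ((hmem e').2 he') hlt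
        rw [hπ, hπ] at this
        exact Or.inl ((noncrossing_iff hU hV G e e').2 ⟨hlt, this⟩)
      · have := h ((hmem e').2 he') ((hmem e).2 he) hlt
        rw [hπ, hπ] at this
        exact Or.inr ((noncrossing_iff hU hV G e' e).2 ⟨hlt, this⟩)
  rw [maxPlanarMatching, Finset.sup_le_iff]
  constructor
  · intro h S hS
    have hmap : (S.map E.symm.toEmbedding).map E.toEmbedding = S := by
      ext a
      simp
    have := h (S.map E.symm.toEmbedding) (by
      rw [Finset.mem_filter, key, hmap]
      exact ⟨Finset.mem_univ _, hS⟩)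
    simpa using this
  · intro h M hM
    rw [Finset.mem_filter, key] at hM
    simpa using h _ hM.2

end RegularMultigraph

theorem mem_planarConfigurations_iff {n : ℕ} (hU : Fintype.card U = n) (hV : Fintype.card V = n)
    (d : ℕ) (F : Configuration U V r) :
    F ∈ planarConfigurations U V r d ↔ F.IsBlockDecreasing ∧
      Configuration.IsBlockDecreasing (U := V) (V := U) F.symm ∧
      numCols (rsk (F.toPerm hU hV)).1 ≤ d := by
  rw [numCols_rsk_le_iff]
  constructor
  · rintro ⟨G, hG, rfl⟩
    exact ⟨G.isBlockDecreasing_toConfiguration, G.isBlockDecreasing_toConfiguration_symm,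
      (G.maxPlanarMatching_le_iff hU hV d).1 hG⟩
  · rintro ⟨h1, h2, h3⟩
    have h := Configuration.toConfiguration_toMultigraph h1 h2
    refine ⟨F.toMultigraph, ?_, h⟩
    rw [planarMultigraphs, Set.mem_ofPred_eq, RegularMultigraph.maxPlanarMatching_le_iff hU hV, h]
    exact h3

theorem numCols_eq_of_shape_eq {P Q : Filling} (h : shape P = shape Q) :
    numCols P = numCols Q := by
  rw [numCols, numCols, ← shape_headD, ← shape_headD, h]

theorem toPerm_surjective {n : ℕ} (hU : Fintype.card U = n) (hV : Fintype.card V = n)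
    (π : Equiv.Perm (Fin (n * r))) : ∃ F : Configuration U V r, F.toPerm hU hV = π :=
  ⟨((lexRank hU).trans π).trans (lexRank hV).symm, by ext; simp [Configuration.toPerm]⟩

theorem toPerm_injective {n : ℕ} (hU : Fintype.card U = n) (hV : Fintype.card V = n) :
    Function.Injective (Configuration.toPerm (r := r) hU hV) := by
  intro F F' h
  ext1 p
  have := congrArg (fun π => π (lexRank hU p)) h
  simpa [Configuration.toPerm] using this

theorem bijOn_rsk (n d : ℕ) (hU : Fintype.card U = n) (hV : Fintype.card V = n) :
    Set.BijOn (fun F : Configuration U V r => rsk (F.toPerm hU hV))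
      (planarConfigurations U V r d) (tableauPairs n r d) := by
  refine ⟨?_, ?_, ?_⟩
  · intro F hF
    obtain ⟨h1, h2, h3⟩ := (mem_planarConfigurations_iff hU hV d F).1 hF
    obtain ⟨h4, h5, h6⟩ := rsk_spec (F.toPerm hU hV)
    exact ⟨h4, h5, h6, h3, numCols_eq_of_shape_eq h6 ▸ h3, (conditionT_rsk_fst_iff hU hV F).2 h2,
      (conditionT_rsk_snd_iff hU hV F).2 h1⟩
  · exact (rsk_injective.comp (toPerm_injective hU hV)).injOn
  · rintro ⟨P, Q⟩ ⟨h1, h2, h3, h4, -, h5, h6⟩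
    obtain ⟨π, hπ⟩ := exists_rsk_eq h1 h2 h3
    obtain ⟨F, rfl⟩ := toPerm_surjective (r := r) hU hV π
    refine ⟨F, (mem_planarConfigurations_iff hU hV d F).2 ⟨?_, ?_, ?_⟩, hπ⟩
    · rw [← conditionT_rsk_snd_iff hU hV, hπ]
      exact h6
    · rw [← conditionT_rsk_fst_iff hU hV, hπ]
      exact h5
    · rw [hπ]
      exact h4

end Configurations

end PlanarRSK

theorem mainTheorem2 (n r d : ℕ) {U V : Type*} [LinearOrder U] [Fintype U] [LinearOrder V]
    [Fintype V] (hU : Fintype.card U = n) (hV : Fintype.card V = n) :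
    Set.BijOn (fun F : PlanarRSK.Configuration U V r => PlanarRSK.rsk (F.toPerm hU hV))
      (PlanarRSK.planarConfigurations U V r d) (PlanarRSK.tableauPairs n r d) ∧
    (PlanarRSK.planarMultigraphs U V r d).Finite ∧
    (PlanarRSK.tableauPairs n r d).Finite ∧
    (PlanarRSK.planarMultigraphs U V r d).ncard = (PlanarRSK.tableauPairs n r d).ncard := by
  have hbij := PlanarRSK.bijOn_rsk (r := r) n d hU hV
  have hinj := PlanarRSK.RegularMultigraph.toConfiguration_injective (U := U) (V := V) (r := r)
  -- All configurations together are finite in number; finiteness passes to the multigraphs by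
  -- injectivity and to the tableau pairs as an image.
  have hfin : (PlanarRSK.planarConfigurations U V r d).Finite := Set.toFinite _
  refine ⟨hbij, Set.Finite.of_finite_image hfin hinj.injOn, ?_, ?_⟩
  · rw [← hbij.image_eq]
    exact hfin.image _
  · rw [← hbij.image_eq, hbij.injOn.ncard_image, PlanarRSK.planarConfigurations,
      Set.ncard_image_of_injective _ hinj]
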